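/- Let $S$ be a set of $n$ red and $n$ blue points in the plane. A *set of rays from $S$* consists of one ray with apex $p$ for each $p\in S$, coloured like its apex. A *configuration* is a circular sequence (a word up to cyclic rotation) of $n$ letters $r$ and $n$ letters $b$. A set of rays from $S$ *realizes* the configuration obtained by reading, in clockwise order, the colours of the points where the rays meet any sufficiently large circle. A configuration is *feasible* from $S$ if it is realized by a set of pairwise disjoint rays from $S$, and *$\chi$-feasible* from $S$ if it is realized by a set of rays from $S$ any two of which cross, that is, meet in exactly one point which is the apex of neither. Let $\gamma(S)$ and $\mu(S)$ be the numbers of configurations that are feasible, respectively $\chi$-feasible, from $S$. **Theorem.** There are point sets whose number of feasible configurations is asymptotically larger than their number of $\chi$-feasible configurations. More precisely, for each $n$ there is a set of $n$ red and $n$ blue points on a semicircle (the closed upper half of a circle) whose colours alternate along the semicircle, and for every sequence $(S_n)_{n}$ of such sets, $S_n$ having $2n$ points, as $n\to\infty$, $$\gamma(S_n)=\Omega\!\left(\frac{3^n}{n^2}\right),\qquad \mu(S_n)=O\!\left(\Phi^{2n}\right),\qquad \frac{\mu(S_n)}{\gamma(S_n)}\to 0,$$ where $\Phi=\frac{1+\sqrt5}{2}$.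 -/

import Mathlib

open Filter Asymptotics

noncomputable section

/-- The two colours. -/
inductive Color where
  | red : Color
  | blue : Color
  deriving DecidableEq

/-- A balanced bichromatic point set in the Euclidean plane (identified with `ℂ`):
`n` red points and `n` blue points, no point having both colours. -/
structure BichromaticSet (n : ℕ) where
  red : Finset ℂ
  blue : Finset ℂ
  disjoint : Disjoint red blue
  card_red : red.card = n
  card_blue : blue.card = n

/-- A configuration: a circular sequence (a word up to cyclic rotation) with exactly `n` red and
exactly `n` blue elements. -/
def Configuration (n : ℕ) : Type :=
  {c : Cycle Color // c.toMultiset.count Color.red = n ∧ c.toMultiset.count Color.blue = n}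

/-- The ray with apex `p` and direction `v`. -/
def ray (p v : ℂ) : Set ℂ := {z | ∃ t : ℝ, 0 ≤ t ∧ z = p + (t : ℂ) * v}

/-- Two rays cross if they have exactly one common point and this point is not an apex. -/
def RaysCross (p v q w : ℂ) : Prop :=
  ∃ z : ℂ, ray p v ∩ ray q w = {z} ∧ z ≠ p ∧ z ≠ q

namespace BichromaticSet

variable {n : ℕ}

/-- All points of the set. -/
def points (S : BichromaticSet n) : Finset ℂ := S.red ∪ S.blue

/-- The colour of a point of the set (only used for points of the set). -/
def color (S : BichromaticSet n) (p : ℂ) : Color := if p ∈ S.red then Color.red else Color.blue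

/-- `v` gives a set of rays from `S`: one ray for every point `p` of `S`, with apex `p` and
direction the nonzero vector `v p`. -/
def IsRaySet (S : BichromaticSet n) (v : ℂ → ℂ) : Prop := ∀ p ∈ S.points, v p ≠ 0

/-- The rays are pairwise disjoint. -/
def IsDisjointRaySet (S : BichromaticSet n) (v : ℂ → ℂ) : Prop :=
  S.IsRaySet v ∧
    ∀ p ∈ S.points, ∀ q ∈ S.points, p ≠ q → Disjoint (ray p (v p)) (ray q (v q))

/-- The rays are full-crossing: any two of them cross. -/
def IsFullCrossingRaySet (S : BichromaticSet n) (v : ℂ → ℂ) : Prop :=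
  S.IsRaySet v ∧
    ∀ p ∈ S.points, ∀ q ∈ S.points, p ≠ q → RaysCross p (v p) q (v q)

/-- The list `l` enumerates the points of `S`, each once, in the clockwise order in which their
rays meet the circle of radius `ρ` about the origin: there are angles `θ p` such that the ray from
`p` meets the circle at angle `θ p`, and along `l` these angles strictly decrease within less than
one full turn. -/
def IsClockwiseOn (S : BichromaticSet n) (v : ℂ → ℂ) (ρ : ℝ) (l : List ℂ) : Prop :=
  l.Nodup ∧ (∀ p, p ∈ l ↔ p ∈ S.points) ∧
    ∃ θ : ℂ → ℝ,
      (∀ p ∈ S.points, (ρ : ℂ) * Complex.exp ((θ p : ℂ) * Complex.I) ∈ ray p (v p)) ∧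
      l.Pairwise fun p q => θ q < θ p ∧ θ p < θ q + 2 * Real.pi

/-- The circular colour sequence induced at infinity, in clockwise order, by the rays from `S`
with directions `v` is `c`: on every sufficiently large circle, the colours of the intersection
points of the rays with the circle, read clockwise, form `c`. -/
def Realizes (S : BichromaticSet n) (v : ℂ → ℂ) (c : Configuration n) : Prop :=
  ∀ᶠ ρ : ℝ in atTop, ∃ l : List ℂ, S.IsClockwiseOn v ρ l ∧ (l.map S.color : Cycle Color) = c.1

/-- `c` is feasible from `S`: it is realized by pairwise-disjoint rays from `S`. -/
def Feasible (S : BichromaticSet n) (c : Configuration n) : Prop :=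
  ∃ v : ℂ → ℂ, S.IsDisjointRaySet v ∧ S.Realizes v c

/-- `c` is `χ`-feasible from `S`: it is realized by full-crossing rays from `S`. -/
def ChiFeasible (S : BichromaticSet n) (c : Configuration n) : Prop :=
  ∃ v : ℂ → ℂ, S.IsFullCrossingRaySet v ∧ S.Realizes v c

/-- The number of configurations feasible from `S`. -/
def numFeasible (S : BichromaticSet n) : ℕ := {c : Configuration n | S.Feasible c}.ncard

/-- The number of configurations `χ`-feasible from `S`. -/
def numChiFeasible (S : BichromaticSet n) : ℕ := {c : Configuration n | S.ChiFeasible c}.ncard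

/-- The points of `S` lie on a semicircle (the closed upper half of some circle, whose endpoints
lie on a horizontal line), and their colours alternate along it, from left to right. -/
def AlternatesOnSemicircle (S : BichromaticSet n) : Prop :=
  ∃ (z : ℂ) (r : ℝ) (p : Fin (2 * n) → ℂ), 0 < r ∧
    (∀ i, ‖p i - z‖ = r ∧ z.im ≤ (p i).im) ∧
    StrictMono (fun i => (p i).re) ∧
    (∀ x, x ∈ S.points ↔ ∃ i, p i = x) ∧
    ∀ i j : Fin (2 * n), (i : ℕ) + 1 = (j : ℕ) → S.color (p i) ≠ S.color (p j)

end BichromaticSet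

/-- There are finitely many configurations, so the cardinalities above are genuine counts. -/
theorem Configuration.finite (n : ℕ) : Finite (Configuration n) := by
  have hfin : Set.Finite {l : List Color | l.length ≤ 2 * n} := by
    have : Finite Color :=
      Finite.of_injective (fun c : Color => decide (c = Color.red)) (by
        intro a b h; cases a <;> cases b <;> simp_all)
    exact List.finite_length_le Color (2 * n)
  have himg := hfin.image (fun l : List Color => (l : Cycle Color))
  refine Set.Finite.to_subtype (himg.subset ?_)
  rintro c ⟨hr, hb⟩
  induction c using Quotient.inductionOn with
  | h l =>
    change (l : Cycle Color).toMultiset.count Color.red = n at hr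
    change (l : Cycle Color).toMultiset.count Color.blue = n at hb
    refine ⟨l, ?_, rfl⟩
    have key : ∀ m : List Color, m.length = m.count Color.red + m.count Color.blue := by
      intro m
      induction m with
      | nil => rfl
      | cons a t ih => cases a <;> simp [ih] <;> omega
    have h1 : l.count Color.red = n := by simpa using hr
    have h2 : l.count Color.blue = n := by simpa using hb
    have h3 := key l
    change l.length ≤ 2 * n
    omega

end

/-! Lower bound. Shoot every ray vertically, up or down. Distinct abscissae make the rays disjoint,
and clockwise at infinity one reads the upward points from left to right, then the downward ones
from right to left. So every splitting of the alternating word into two subwords gives a feasible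
configuration. At least `3 ^ n` splittings are distinct (`three_pow_le_card_normal`), and at most
`(2 * n + 1) ^ 2` of them share a configuration, since a rotation and a cut position recover the
splitting.

Upper bound. For pairwise crossing rays, the sign of the turn between two directions tells on which
side of one ray the other apex lies. With apices in convex position this constrains the tournament
of turns (`CrossingTournament`). Either the leftmost ray is in a cyclic triangle, and then the rays
appear at infinity in the order of their apices, or all directions fit in a half-plane, and then
every prefix of the angular order dominates the rest. Both ways, after a rotation each prefix is an
arc of the cyclic order of the apices (`exists_rotation`). Colours alternate, so an arc is balanced
up to one, and an arc of even size is balanced exactly. Hence the word is a sequence of `n`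
two-letter blocks, each `rb` or `br`: at most `2 ^ n` configurations, with `2 < Φ ^ 2 < 3`. -/

/-! ### Splittings of the alternating word -/

/-- A splitting of a word: the letters of the first and of the second part, latest letter first. -/
abbrev Splitting : Type := List Bool × List Bool

namespace Splitting

/-- The first part ends with the factor `false true`. -/
def EndsPair (s : Splitting) : Prop := s.1.take 2 = [true, false]

/-- The first part ends with `false`. -/
def FstFalse (s : Splitting) : Prop := s.1.head? = some false

/-- The second part ends with `false`. -/
def SndFalse (s : Splitting) : Prop := s.2.head? = some false

instance : DecidablePred EndsPair := fun _ => inferInstanceAs (Decidable (_ = _))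
instance : DecidablePred FstFalse := fun _ => inferInstanceAs (Decidable (_ = _))
instance : DecidablePred SndFalse := fun _ => inferInstanceAs (Decidable (_ = _))

/-- Both new letters go to the first part. -/
def pushFst (s : Splitting) : Splitting := (true :: false :: s.1, s.2)

/-- Both new letters go to the second part. -/
def pushSnd (s : Splitting) : Splitting := (s.1, true :: false :: s.2)

/-- The letter `false` goes to the first part and `true` to the second. -/
def pushFstSnd (s : Splitting) : Splitting := (false :: s.1, true :: s.2)

/-- The letter `false` goes to the second part and `true` to the first. -/
def pushSndFst (s : Splitting) : Splitting := (true :: s.1, false :: s.2)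

/-- Splittings of the alternating word of length `2 * n` in a normal form that can be decoded
from its last letters. -/
def normal : ℕ → Finset Splitting
  | 0 => {([], [])}
  | n + 1 =>
    -- The filters make the four images disjoint: the last letters of the two parts reveal which
    -- push came last.
    (normal n).image pushFst ∪
      (((normal n).filter fun s => ¬ s.EndsPair).image pushSnd ∪
        (((normal n).filter fun s => ¬ s.SndFalse).image pushFstSnd ∪
          ((normal n).filter fun s => ¬ s.FstFalse).image pushSndFst))

/-- A weight whose sum over the normal splittings triples with each step. -/
def weight (s : Splitting) : ℕ :=
  (if s.EndsPair ∨ s.FstFalse then 1 else 2) + if s.SndFalse then 0 else 1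

theorem weight_le (s : Splitting) : s.weight ≤ 3 := by
  unfold weight; split_ifs <;> omega

/-- Which pushes are allowed depends only on the three end conditions, so the count is governed by a
finite transfer matrix; `weight` is an eigenvector of it with eigenvalue 3. -/
theorem weight_push (s : Splitting) :
    s.pushFst.weight + ((if ¬ s.EndsPair then s.pushSnd.weight else 0) +
      ((if ¬ s.SndFalse then s.pushFstSnd.weight else 0) +
        if ¬ s.FstFalse then s.pushSndFst.weight else 0)) = 3 * s.weight := by
  obtain ⟨u, d⟩ := s
  rcases u with _ | ⟨_ | _, _ | ⟨_ | _, u⟩⟩ <;> rcases d with _ | ⟨_ | _, d⟩ <;>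
    simp [weight, pushFst, pushSnd, pushFstSnd, pushSndFst, EndsPair, SndFalse, FstFalse]

theorem sum_weight_normal (n : ℕ) : ∑ s ∈ normal n, s.weight = 3 ^ (n + 1) := by
  induction n with
  | zero => simp [normal, weight, EndsPair, SndFalse, FstFalse]
  | succ n ih =>
    have h1 : Disjoint ((normal n).image pushFst)
        (((normal n).filter fun s => ¬ s.EndsPair).image pushSnd ∪
        (((normal n).filter fun s => ¬ s.SndFalse).image pushFstSnd ∪
          ((normal n).filter fun s => ¬ s.FstFalse).image pushSndFst)) := by
      rw [Finset.disjoint_left]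
      simp only [Finset.mem_image, Finset.mem_union, Finset.mem_filter, not_or]
      rintro _ ⟨⟨u, d⟩, -, rfl⟩
      refine ⟨?_, ?_, ?_⟩ <;> rintro ⟨⟨u', d'⟩, ⟨-, h⟩, h'⟩ <;>
        simp_all [pushFst, pushSnd, pushFstSnd, pushSndFst, EndsPair, FstFalse]
    have h2 : Disjoint (((normal n).filter fun s => ¬ s.EndsPair).image pushSnd)
        (((normal n).filter fun s => ¬ s.SndFalse).image pushFstSnd ∪
          ((normal n).filter fun s => ¬ s.FstFalse).image pushSndFst) := by
      rw [Finset.disjoint_left]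
      simp only [Finset.mem_image, Finset.mem_union, Finset.mem_filter, not_or]
      rintro _ ⟨⟨u, d⟩, -, rfl⟩
      refine ⟨?_, ?_⟩ <;> rintro ⟨⟨u', d'⟩, ⟨-, h⟩, h'⟩ <;>
        simp_all [pushSnd, pushFstSnd, pushSndFst, EndsPair, SndFalse, FstFalse]
    have h3 : Disjoint (((normal n).filter fun s => ¬ s.SndFalse).image pushFstSnd)
          (((normal n).filter fun s => ¬ s.FstFalse).image pushSndFst) := by
      rw [Finset.disjoint_left]
      simp only [Finset.mem_image, Finset.mem_filter]
      rintro _ ⟨⟨u, d⟩, -, rfl⟩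
      rintro ⟨⟨u', d'⟩, ⟨-, h⟩, h'⟩
      simp [pushFstSnd, pushSndFst] at h'
    have i1 : Function.Injective pushFst := by
      rintro ⟨u, d⟩ ⟨u', d'⟩ h; simpa [pushFst] using h
    have i2 : Function.Injective pushSnd := by
      rintro ⟨u, d⟩ ⟨u', d'⟩ h; simpa [pushSnd] using h
    have i3 : Function.Injective pushFstSnd := by
      rintro ⟨u, d⟩ ⟨u', d'⟩ h; simpa [pushFstSnd] using h
    have i4 : Function.Injective pushSndFst := by
      rintro ⟨u, d⟩ ⟨u', d'⟩ h; simpa [pushSndFst] using h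
    rw [normal, Finset.sum_union h1, Finset.sum_union h2, Finset.sum_union h3,
      Finset.sum_image i1.injOn, Finset.sum_image i2.injOn, Finset.sum_image i3.injOn,
      Finset.sum_image i4.injOn, Finset.sum_filter, Finset.sum_filter, Finset.sum_filter,
      ← Finset.sum_add_distrib, ← Finset.sum_add_distrib, ← Finset.sum_add_distrib,
      Finset.sum_congr rfl fun s _ => weight_push s, ← Finset.mul_sum, ih]
    ring

theorem three_pow_le_card_normal (n : ℕ) : 3 ^ n ≤ (normal n).card := by
  have h := Finset.sum_le_card_nsmul (normal n) weight 3 fun s _ => weight_le s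
  rw [sum_weight_normal, smul_eq_mul, pow_succ] at h
  omega

end Splitting

/-! ### Shuffles, and the size of the fibres of splitting ↦ circular word. -/

/-- `Interleaves l u d`: the list `l` is a shuffle of `u` and `d`. -/
inductive Interleaves {α : Type*} : List α → List α → List α → Prop
  | nil : Interleaves [] [] []
  | fst (a : α) {l u d : List α} : Interleaves l u d → Interleaves (a :: l) (a :: u) d
  | snd (a : α) {l u d : List α} : Interleaves l u d → Interleaves (a :: l) u (a :: d)

namespace Interleaves

variable {α β : Type*}

theorem perm {l u d : List α} (h : Interleaves l u d) : l.Perm (u ++ d) := by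
  induction h with
  | nil => simp
  | fst a _ ih => exact ih.cons a
  | snd a _ ih => exact (ih.cons a).trans List.perm_middle.symm

theorem sublist_fst {l u d : List α} (h : Interleaves l u d) : u.Sublist l := by
  induction h with
  | nil => simp
  | fst a _ ih => exact ih.cons_cons a
  | snd a _ ih => exact ih.cons a

theorem sublist_snd {l u d : List α} (h : Interleaves l u d) : d.Sublist l := by
  induction h with
  | nil => simp
  | fst a _ ih => exact ih.cons a
  | snd a _ ih => exact ih.cons_cons a

theorem map (f : α → β) {l u d : List α} (h : Interleaves l u d) :
    Interleaves (l.map f) (u.map f) (d.map f) := by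
  induction h with
  | nil => exact .nil
  | fst a _ ih => exact ih.fst _
  | snd a _ ih => exact ih.snd _

theorem exists_of_map {f : α → β} {l : List α} {u d : List β} (h : Interleaves (l.map f) u d) :
    ∃ u' d', Interleaves l u' d' ∧ u'.map f = u ∧ d'.map f = d := by
  induction l generalizing u d with
  | nil => cases h; exact ⟨[], [], .nil, rfl, rfl⟩
  | cons a l ih =>
    cases h with
    | fst _ h =>
      obtain ⟨u', d', h', rfl, rfl⟩ := ih h
      exact ⟨a :: u', d', h'.fst a, rfl, rfl⟩
    | snd _ h =>
      obtain ⟨u', d', h', rfl, rfl⟩ := ih h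
      exact ⟨u', a :: d', h'.snd a, rfl, rfl⟩

end Interleaves

/-- The alternating word of length `m`, latest letter first. -/
def alternatingWord (m : ℕ) : List Bool := (List.range m).reverse.map fun i => decide (i % 2 = 1)

theorem alternatingWord_add_two (n : ℕ) :
    alternatingWord (2 * (n + 1)) = true :: false :: alternatingWord (2 * n) := by
  have : 2 * (n + 1) = 2 * n + 1 + 1 := by ring
  rw [alternatingWord, alternatingWord, this, List.range_succ, List.range_succ]
  simp

theorem Splitting.interleaves_of_mem_normal {n : ℕ} {s : Splitting} (h : s ∈ normal n) :
    Interleaves (alternatingWord (2 * n)) s.1 s.2 := by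
  induction n generalizing s with
  | zero => 
    simp only [normal, Finset.mem_singleton] at h
    subst h
    exact .nil
  | succ n ih =>
    rw [alternatingWord_add_two]
    simp only [normal, Finset.mem_union, Finset.mem_image, Finset.mem_filter] at h
    rcases h with ⟨s, h, rfl⟩ | ⟨s, ⟨h, -⟩, rfl⟩ | ⟨s, ⟨h, -⟩, rfl⟩ | ⟨s, ⟨h, -⟩, rfl⟩
    · exact ((ih h).fst _).fst _
    · exact ((ih h).snd _).snd _
    · exact ((ih h).fst _).snd _
    · exact ((ih h).snd _).fst _

/-- Few splittings have the same word up to rotation. -/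
theorem Splitting.card_filter_cycle_le (A : Finset Splitting) (m : ℕ) (f : Bool → Color)
    (hf : Function.Injective f) (hA : ∀ s ∈ A, s.1.length + s.2.length = m) (c : Cycle Color) :
    {s ∈ A | (((s.1.reverse ++ s.2).map f : List Color) : Cycle Color) = c}.card
      ≤ (m + 1) * (m + 1) := by
  classical
  rcases Finset.eq_empty_or_nonempty
    {s ∈ A | (((s.1.reverse ++ s.2).map f : List Color) : Cycle Color) = c} with h0 | ⟨s₀, h₀⟩
  · rw [h0]
    simp
  · rw [Finset.mem_filter] at h₀
    obtain ⟨hs₀, hc⟩ := h₀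
    have hlen : (s₀.1.reverse ++ s₀.2).length = m := by simpa using hA _ hs₀
    -- Fix one splitting in the fibre. Any other is obtained by rotating its word by some `j` and
    -- cutting at the length of the first part.
    have key : {s ∈ A | (((s.1.reverse ++ s.2).map f : List Color) : Cycle Color) = c} ⊆
        ((Finset.range (m + 1)) ×ˢ (Finset.range (m + 1))).image fun jk : ℕ × ℕ =>
          ((((s₀.1.reverse ++ s₀.2).rotate jk.1).take jk.2).reverse,
            ((s₀.1.reverse ++ s₀.2).rotate jk.1).drop jk.2) := by
      intro s hs
      rw [Finset.mem_filter] at hs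
      obtain ⟨hs, hsc⟩ := hs
      rw [← hc, Cycle.coe_eq_coe] at hsc
      obtain ⟨j, hj, hr⟩ := List.isRotated_iff_mod.1 hsc.symm
      rw [← List.map_rotate] at hr
      have hr' := (List.map_injective_iff.2 hf) hr
      rw [Finset.mem_image]
      refine ⟨(j, s.1.length), ?_, ?_⟩
      · have := hA s hs
        simp only [List.length_map, hlen] at hj
        simp only [Finset.mem_product, Finset.mem_range]
        omega
      · simp only [hr']
        ext1 <;> simp
    refine (Finset.card_le_card key).trans (Finset.card_image_le.trans ?_)
    simp

/-- The circular word of a configuration. -/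
def Configuration.cycle {n : ℕ} (c : Configuration n) : Cycle Color := c.1

theorem Configuration.cycle_injective {n : ℕ} :
    Function.Injective (Configuration.cycle : Configuration n → Cycle Color) :=
  fun _ _ h => Subtype.ext h

/-! ### Lower bound: vertical rays. -/

namespace BichromaticSet

variable {n : ℕ}

theorem color_eq_red_iff (S : BichromaticSet n) {p : ℂ} : S.color p = Color.red ↔ p ∈ S.red := by
  unfold color; split_ifs with h <;> simp [h]

theorem color_eq_blue_iff (S : BichromaticSet n) {p : ℂ} : S.color p = Color.blue ↔ p ∉ S.red := by
  unfold color; split_ifs with h <;> simp [h]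

/-- The configuration read along an enumeration of the points. -/
theorem exists_configuration (S : BichromaticSet n) {l : List ℂ} (hl : l.Nodup)
    (hmem : ∀ p, p ∈ l ↔ p ∈ S.points) :
    ∃ c : Configuration n, c.1 = (l.map S.color : Cycle Color) := by
  have key : ∀ (k : Color) (A : Finset ℂ), (∀ p, (p ∈ S.points ∧ S.color p = k) ↔ p ∈ A) →
      (l.map S.color).count k = A.card := by
    intro k A hA
    rw [List.count_eq_countP, List.countP_map, List.countP_eq_length_filter,
      ← List.toFinset_card_of_nodup (hl.filter _)]
    congr 1
    ext p
    simp [hmem, ← hA]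
  have hd := Finset.disjoint_left.1 S.disjoint
  refine ⟨⟨(l.map S.color : Cycle Color), ?_, ?_⟩, rfl⟩
  · rw [Cycle.coe_toMultiset, Multiset.coe_count, key _ S.red, S.card_red]
    intro p
    rw [color_eq_red_iff, points, Finset.mem_union]
    tauto
  · rw [Cycle.coe_toMultiset, Multiset.coe_count, key _ S.blue, S.card_blue]
    intro p
    rw [color_eq_blue_iff, points, Finset.mem_union]
    have := @hd p
    tauto

/-- Colours that alternate along a sequence are determined by the parity of the index. -/
theorem exists_color_eq (S : BichromaticSet n) {m : ℕ} {p : Fin m → ℂ}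
    (halt : ∀ i j : Fin m, (i : ℕ) + 1 = (j : ℕ) → S.color (p i) ≠ S.color (p j)) :
    ∃ h : Bool → Color, Function.Injective h ∧
      ∀ i : Fin m, S.color (p i) = h (decide ((i : ℕ) % 2 = 1)) := by
  obtain ⟨c₀, hc₀⟩ : ∃ c₀, ∀ h : 0 < m, S.color (p ⟨0, h⟩) = c₀ := by
    by_cases h : 0 < m
    · exact ⟨S.color (p ⟨0, h⟩), fun _ => rfl⟩
    · exact ⟨Color.red, fun h' => absurd h' h⟩
  obtain ⟨c₁, hc₁, hother⟩ : ∃ c₁, c₀ ≠ c₁ ∧ ∀ c, c = c₀ ∨ c = c₁ := by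
    cases c₀
    · exact ⟨Color.blue, by simp, fun c => by cases c <;> simp⟩
    · exact ⟨Color.red, by simp, fun c => by cases c <;> simp⟩
  have hcol : ∀ (i : ℕ) (hi : i < m),
      S.color (p ⟨i, hi⟩) = if i % 2 = 1 then c₁ else c₀ := by
    intro i
    induction i with
    | zero => intro hi; simpa using hc₀ hi
    | succ i ih =>
      intro hi
      have h1 := ih (by omega)
      have h2 := halt ⟨i, by omega⟩ ⟨i + 1, hi⟩ rfl
      rw [h1] at h2
      rcases Nat.mod_two_eq_zero_or_one i with h | h
      · have : (i + 1) % 2 = 1 := by omega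
        simp only [h, this, if_true] at h2 ⊢
        exact (hother _).resolve_left fun h' => h2 (by simp [h'])
      · have : (i + 1) % 2 = 0 := by omega
        simp only [h, this, if_true] at h2 ⊢
        simpa using (hother _).resolve_right fun h' => h2 (by simp [h'])
  refine ⟨fun b => if b then c₁ else c₀, ?_, fun i => by simp [hcol i.1 i.2]⟩
  intro a b hab
  cases a <;> cases b <;> simp_all

/-- All that the lower bound needs: the left-to-right order and the alternating colours. The circle
itself plays no role. The list runs from right to left to match `alternatingWord`. -/
theorem AlternatesOnSemicircle.exists_list {S : BichromaticSet n} (hS : S.AlternatesOnSemicircle) :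
    ∃ (L : List ℂ) (h : Bool → Color), Function.Injective h ∧
      L.Pairwise (fun a b => b.re < a.re) ∧ (∀ x, x ∈ L ↔ x ∈ S.points) ∧
      L.map S.color = (alternatingWord (2 * n)).map h := by
  obtain ⟨-, -, p, -, -, hmono, hmem, halt⟩ := hS
  obtain ⟨h, hinj, hcol⟩ := S.exists_color_eq halt
  refine ⟨((List.finRange (2 * n)).map p).reverse, h, hinj, ?_, ?_, ?_⟩
  · rw [List.pairwise_reverse, List.pairwise_map]
    exact (List.pairwise_lt_finRange _).imp fun h => hmono h
  · intro x
    simp [hmem]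
  · rw [alternatingWord, ← List.map_coe_finRange_eq_range, ← List.map_reverse, ← List.map_reverse,
      List.map_map, List.map_map, List.map_map]
    exact List.map_congr_left fun i _ => hcol i

theorem mem_ray_I_iff {p z : ℂ} : z ∈ ray p Complex.I ↔ z.re = p.re ∧ p.im ≤ z.im := by
  constructor
  · rintro ⟨t, ht, rfl⟩
    simp [ht]
  · rintro ⟨h1, h2⟩
    exact ⟨z.im - p.im, by linarith, Complex.ext (by simp [h1]) (by simp)⟩

theorem mem_ray_neg_I_iff {p z : ℂ} : z ∈ ray p (-Complex.I) ↔ z.re = p.re ∧ z.im ≤ p.im := by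
  constructor
  · rintro ⟨t, ht, rfl⟩
    simp [ht]
  · rintro ⟨h1, h2⟩
    exact ⟨p.im - z.im, by linarith, Complex.ext (by simp [h1]) (by simp)⟩

/-- Vertical rays, those of `U` upwards and those of `D` downwards. -/
theorem feasible_of_interleaves (S : BichromaticSet n) {L U D : List ℂ}
    (hL : L.Pairwise fun a b => b.re < a.re) (hmem : ∀ x, x ∈ L ↔ x ∈ S.points)
    (hI : Interleaves L U D) {c : Configuration n}
    (hc : ((U.reverse ++ D).map S.color : Cycle Color) = c.1) : S.Feasible c := by
  classical
  have hnd : L.Nodup := hL.imp fun h => by rintro rfl; exact lt_irrefl _ h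
  have hU := hL.sublist hI.sublist_fst
  have hD := hL.sublist hI.sublist_snd
  have hnd' : (U ++ D).Nodup := hI.perm.nodup_iff.1 hnd
  have hUD : ∀ x ∈ U, x ∉ D := fun x h h' => (List.nodup_append.1 hnd').2.2 x h x h' rfl
  have hmem' : ∀ x, (x ∈ U ∨ x ∈ D) ↔ x ∈ S.points := fun x => by
    rw [← hmem, hI.perm.mem_iff, List.mem_append]
  have hre : ∀ a ∈ L, ∀ b ∈ L, a ≠ b → a.re ≠ b.re := by
    intro a ha b hb hab
    have hL' := List.pairwise_iff_getElem.1 hL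
    obtain ⟨i, hi, rfl⟩ := List.getElem_of_mem ha
    obtain ⟨j, hj, rfl⟩ := List.getElem_of_mem hb
    rcases lt_trichotomy i j with h | rfl | h
    · exact (hL' i j hi hj h).ne'
    · exact absurd rfl hab
    · exact (hL' j i hj hi h).ne
  let v : ℂ → ℂ := fun x => if x ∈ U then Complex.I else -Complex.I
  have hray : ∀ x z, z ∈ ray x (v x) → z.re = x.re := by
    intro x z hz
    by_cases hx : x ∈ U
    · simp only [v, hx, if_true] at hz; exact (mem_ray_I_iff.1 hz).1
    · simp only [v, hx, if_false] at hz; exact (mem_ray_neg_I_iff.1 hz).1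
  refine ⟨v, ⟨fun x _ => ?_, fun x hx y hy hxy => ?_⟩, ?_⟩
  · by_cases hx : x ∈ U <;> simp [v, hx]
  · rw [Set.disjoint_left]
    intro z hz hz'
    exact hre x ((hmem x).2 hx) y ((hmem y).2 hy) hxy ((hray x z hz).symm.trans (hray y z hz'))
  · have hev : ∀ᶠ ρ : ℝ in atTop, 0 < ρ ∧ ∀ x ∈ S.points, ‖x‖ < ρ := by
      refine (eventually_gt_atTop 0).and ?_
      rw [eventually_all_finset]
      exact fun x _ => eventually_gt_atTop _
    filter_upwards [hev] with ρ ⟨hρ, hρx⟩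
    refine ⟨U.reverse ++ D, ⟨?_, ?_, ?_⟩, hc⟩
    · exact (List.Perm.append_right D (List.reverse_perm U)).nodup_iff.2 hnd'
    · intro x; simpa using hmem' x
    have hq : ∀ x ∈ S.points, |x.re / ρ| < 1 ∧ |x.im| ≤ ρ * Real.sin (Real.arccos (x.re / ρ)) := by
      intro x hx
      have h1 := hρx x hx
      have h2 : |x.re / ρ| < 1 := by
        rw [abs_div, abs_of_pos hρ, div_lt_one hρ]
        exact (Complex.abs_re_le_norm x).trans_lt h1
      refine ⟨h2, ?_⟩
      rw [Real.sin_arccos, ← Real.sqrt_sq hρ.le, ← Real.sqrt_mul (sq_nonneg ρ), Real.sqrt_sq hρ.le]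
      apply Real.abs_le_sqrt
      have h3 : ρ ^ 2 * (1 - (x.re / ρ) ^ 2) = ρ ^ 2 - x.re ^ 2 := by field_simp
      have h4 : ‖x‖ ^ 2 = x.re ^ 2 + x.im ^ 2 := by
        rw [← Complex.normSq_eq_norm_sq, Complex.normSq_apply]; ring
      have h5 : ‖x‖ ^ 2 < ρ ^ 2 := by gcongr
      rw [h3]; linarith
    have hmap : ∀ φ : ℝ, ((ρ : ℂ) * Complex.exp ((φ : ℂ) * Complex.I)).re = ρ * Real.cos φ ∧
        ((ρ : ℂ) * Complex.exp ((φ : ℂ) * Complex.I)).im = ρ * Real.sin φ := by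
      intro φ
      rw [Complex.exp_mul_I, ← Complex.ofReal_cos, ← Complex.ofReal_sin]
      constructor <;> simp [-Complex.ofReal_cos, -Complex.ofReal_sin]
    have hcos : ∀ x ∈ S.points, ρ * Real.cos (Real.arccos (x.re / ρ)) = x.re := by
      intro x hx
      have := abs_lt.1 (hq x hx).1
      rw [Real.cos_arccos this.1.le this.2.le]; field_simp
    -- The vertical line through `x` meets the circle at angles `± arccos (x.re / ρ)`. Angles
    -- decreasing from `π` to `-π` sweep the upper half from left to right, then the lower half from
    -- right to left.
    refine ⟨fun x => if x ∈ U then Real.arccos (x.re / ρ) else -Real.arccos (x.re / ρ), ?_, ?_⟩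
    · intro x hx
      have h1 := hcos x hx
      have h2 := abs_le.1 (hq x hx).2
      by_cases hxU : x ∈ U
      · simp only [v, hxU, if_true]
        rw [mem_ray_I_iff, (hmap _).1, (hmap _).2]
        exact ⟨h1, h2.2⟩
      · simp only [v, hxU, if_false]
        rw [mem_ray_neg_I_iff, (hmap _).1, (hmap _).2, Real.cos_neg, Real.sin_neg]
        exact ⟨h1, by linarith⟩
    · have hpos : ∀ x ∈ S.points, 0 < Real.arccos (x.re / ρ) ∧ Real.arccos (x.re / ρ) < Real.pi := by
        intro x hx
        have := abs_lt.1 (hq x hx).1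
        refine ⟨Real.arccos_pos.2 this.2, lt_of_le_of_ne (Real.arccos_le_pi _) ?_⟩
        rw [Ne, Real.arccos_eq_pi, not_le]
        exact this.1
      have hlt : ∀ x ∈ S.points, ∀ y ∈ S.points, x.re < y.re →
          Real.arccos (y.re / ρ) < Real.arccos (x.re / ρ) := by
        intro x hx y hy hxy
        have h1 := abs_lt.1 (hq x hx).1
        have h2 := abs_lt.1 (hq y hy).1
        exact Real.strictAntiOn_arccos ⟨h1.1.le, h1.2.le⟩ ⟨h2.1.le, h2.2.le⟩
          (by gcongr)
      rw [List.pairwise_append, List.pairwise_reverse]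
      refine ⟨hU.imp_of_mem ?_, hD.imp_of_mem ?_, ?_⟩
      · intro a b ha hb hab
        have ha' := (hmem' a).1 (.inl ha)
        have hb' := (hmem' b).1 (.inl hb)
        simp only [ha, hb, if_true]
        have := hlt b hb' a ha' hab
        exact ⟨this, by linarith [hpos a ha', hpos b hb']⟩
      · intro a b ha hb hab
        have ha' := (hmem' a).1 (.inr ha)
        have hb' := (hmem' b).1 (.inr hb)
        have haU : a ∉ U := fun h => hUD a h ha
        have hbU : b ∉ U := fun h => hUD b h hb
        simp only [haU, hbU, if_false]
        have := hlt b hb' a ha' hab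
        exact ⟨by linarith, by linarith [hpos a ha', hpos b hb']⟩
      · intro a ha b hb
        have ha := List.mem_reverse.1 ha
        have ha' := (hmem' a).1 (.inl ha)
        have hb' := (hmem' b).1 (.inr hb)
        have hbU : b ∉ U := fun h => hUD b h hb
        simp only [ha, hbU, if_false, if_true]
        exact ⟨by linarith [hpos a ha', hpos b hb'], by linarith [hpos a ha', hpos b hb']⟩

theorem AlternatesOnSemicircle.three_pow_le {S : BichromaticSet n}
    (hS : S.AlternatesOnSemicircle) : 3 ^ n ≤ (2 * n + 1) ^ 2 * S.numFeasible := by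
  classical
  obtain ⟨L, h, hinj, hL, hmem, hcol⟩ := hS.exists_list
  have hnd : L.Nodup := hL.imp fun h => by rintro rfl; exact lt_irrefl _ h
  have hF : (Configuration.cycle '' {c : Configuration n | S.Feasible c}).Finite := by
    have := Configuration.finite n
    exact (Set.toFinite _).image _
  have hnum : hF.toFinset.card = S.numFeasible := by
    rw [← Set.ncard_eq_toFinset_card _ hF, numFeasible,
      Set.ncard_image_of_injective _ Configuration.cycle_injective]
  have hfib := Finset.card_le_mul_card_image_of_maps_to (s := Splitting.normal n)
    (t := hF.toFinset)
    (f := fun s => (((s.1.reverse ++ s.2).map h : List Color) : Cycle Color)) ?_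
    ((2 * n + 1) ^ 2) ?_
  · rw [hnum] at hfib
    exact (Splitting.three_pow_le_card_normal n).trans hfib
  · intro s hs
    rw [Set.Finite.mem_toFinset]
    have hI := Splitting.interleaves_of_mem_normal hs
    have hI' : Interleaves (L.map S.color) (s.1.map h) (s.2.map h) := by
      rw [hcol]; exact hI.map h
    obtain ⟨U, D, hUD, hU, hD⟩ := hI'.exists_of_map
    have hp := hUD.perm
    obtain ⟨c, hc⟩ := S.exists_configuration (l := U.reverse ++ D)
      ((List.Perm.append_right D (List.reverse_perm U)).nodup_iff.2 (hp.nodup_iff.1 hnd))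
      (fun x => by rw [← hmem, hp.mem_iff]; simp)
    refine ⟨c, S.feasible_of_interleaves hL hmem hUD hc.symm, ?_⟩
    rw [Configuration.cycle, hc, List.map_append, List.map_reverse, hU, hD]
    simp
  · intro c _
    rw [sq]
    refine Splitting.card_filter_cycle_le _ _ h hinj (fun s hs => ?_) c
    have := (Splitting.interleaves_of_mem_normal hs).perm.length_eq
    rw [List.length_append] at this
    rw [← this]
    simp [alternatingWord]

end BichromaticSet

/-! ### Tournaments of crossing rays -/

/-- The elements `a`, `b`, `c` occur in this cyclic order. -/
def Cyc3 {ι : Type*} [LT ι] (a b c : ι) : Prop :=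
  (a < b ∧ b < c) ∨ (b < c ∧ c < a) ∨ (c < a ∧ a < b)

/-- The elements `a`, `b`, `c`, `d` occur in this cyclic order. -/
def Cyc4 {ι : Type*} [LT ι] (a b c d : ι) : Prop :=
  (a < b ∧ b < c ∧ c < d) ∨ (b < c ∧ c < d ∧ d < a) ∨ (c < d ∧ d < a ∧ a < b) ∨
    (d < a ∧ a < b ∧ b < c)

/-- The properties of the relation "turning clockwise by less than `π` leads from the direction of
the `a`-th ray to that of the `b`-th ray" for pairwise crossing rays with apices in convex
position, numbered clockwise. -/
structure CrossingTournament {ι : Type*} [LinearOrder ι] (T : ι → ι → Prop) : Prop where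
  asymm : ∀ a b, T a b → ¬ T b a
  to_opposite : ∀ a b c d, Cyc4 a b c d → T a b → T c b → T d b
  from_opposite : ∀ a b c d, Cyc4 a b c d → T b a → T b c → T b d
  cyc3 : ∀ a b c, T a b → T b c → T c a → Cyc3 a b c

/-- A subset and its complement do not alternate: no four elements in increasing order are
alternately inside and outside. -/
def NonAlternating {ι : Type*} [LT ι] (Q : ι → Prop) : Prop :=
  ∀ a b c d, a < b → b < c → c < d → ¬ (Q a ∧ ¬ Q b ∧ Q c ∧ ¬ Q d) ∧ ¬ (¬ Q a ∧ Q b ∧ ¬ Q c ∧ Q d)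

namespace CrossingTournament

variable {ι : Type*} [LinearOrder ι] {T : ι → ι → Prop}

theorem ne (hT : CrossingTournament T) {a b : ι} (h : T a b) : a ≠ b := by
  rintro rfl; exact hT.asymm _ _ h h

/-- If `a, c` in `Q` alternate with `b, d` outside, `to_opposite` applied at `b` gives `T d b`, and
applied at `d` gives `T b d`. -/
theorem nonAlternating_of_dominates (hT : CrossingTournament T) {Q : ι → Prop}
    (h : ∀ a b, Q a → ¬ Q b → T a b) : NonAlternating Q := by
  have key : ∀ a b c d, Cyc4 a b c d → Q a → ¬ Q b → Q c → ¬ Q d → False := by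
    intro a b c d hc ha hb hc' hd
    have hcyc : Cyc4 c d a b := by unfold Cyc4 at *; tauto
    exact hT.asymm _ _ (hT.to_opposite a b c d hc (h a b ha hb) (h c b hc' hb))
      (hT.to_opposite c d a b hcyc (h c d hc' hd) (h a d ha hd))
  intro a b c d hab hbc hcd
  refine ⟨fun ⟨h1, h2, h3, h4⟩ => key a b c d (.inl ⟨hab, hbc, hcd⟩) h1 h2 h3 h4,
    fun ⟨h1, h2, h3, h4⟩ => key b c d a (.inr (.inr (.inr ⟨hab, hbc, hcd⟩))) h2 h3 h4 h1⟩

/-- For a cyclic triangle `a b c`, a direction between those of `a` and `b` has its apex on the arc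
from `a` to `b`: `cyc3` orders `a b c`, and on either other arc an opposite rule reverses a known
turn. -/
theorem cyc4_of_between (hT : CrossingTournament T) {a b c d : ι} (hab : T a b) (hbc : T b c)
    (hca : T c a) (had : T a d) (hdb : T d b) (hdc : T c d ∨ T d c) : Cyc4 a d b c := by
  have h3 := hT.cyc3 a b c hab hbc hca
  have n1 := hT.ne had
  have n2 := hT.ne hdb
  have n3 : c ≠ d := by rintro rfl; exact hT.asymm _ _ hca had
  have hcases : Cyc4 a d b c ∨ Cyc4 a b d c ∨ Cyc4 a b c d := by
    unfold Cyc3 at h3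
    unfold Cyc4
    rcases lt_or_gt_of_ne n1 with h | h <;> rcases lt_or_gt_of_ne n2 with h' | h' <;>
      rcases lt_or_gt_of_ne n3 with h'' | h'' <;> rcases h3 with h3 | h3 | h3 <;> grind
  rcases hcases with h | h | h
  · exact h
  · exfalso
    have h' : Cyc4 a b d c := h
    exact hT.asymm _ _ hbc (hT.to_opposite a b d c h' hab hdb)
  · exfalso
    rcases hdc with hcd | hdc
    · exact hT.asymm _ _ hdb (hT.to_opposite c d a b (by unfold Cyc4 at *; tauto) hcd had)
    · exact hT.asymm _ _ hca (hT.from_opposite d a b c (by unfold Cyc4 at *; tauto) had hab)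

/-- If the directions are not contained in a half-plane, then their cyclic order is that of the
apices. -/
theorem lt_of_angle_lt (hT : CrossingTournament T) {α : ι → ℝ} {z : ι} (hz : ∀ x, x ≠ z → z < x)
    (hz0 : α z = 0) (hnn : ∀ x, 0 ≤ α x) (hlt : ∀ x, α x < 2 * Real.pi)
    (hα : ∀ u w, α u < α w → α w - α u < Real.pi ∧ T u w ∨ Real.pi < α w - α u ∧ T w u)
    (hinj : ∀ u w, α u = α w → u = w)
    {x y : ι} (hzx : T z x) (hxy : T x y) (hyz : T y z) {d e : ι} (hde : α d < α e) : d < e := by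
  have hπ := Real.pi_pos
  have htot : ∀ u w, u ≠ w → T u w ∨ T w u := by
    intro u w huw
    rcases lt_trichotomy (α u) (α w) with h | h | h
    · rcases hα u w h with h | h <;> tauto
    · exact absurd (hinj _ _ h) huw
    · rcases hα w u h with h | h <;> tauto
  have hTlt : ∀ u w, α u < α w → α w - α u < Real.pi → T u w := by
    intro u w h h'
    rcases hα u w h with h | h
    · exact h.2
    · linarith
  have hTgt : ∀ u w, α u < α w → T u w → α w - α u < Real.pi := by
    intro u w h h'
    rcases hα u w h with h | h
    · exact h.1
    · exact absurd h' (hT.asymm _ _ h.2)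
  have hTgt' : ∀ u w, α u < α w → T w u → Real.pi < α w - α u := by
    intro u w h h'
    rcases hα u w h with h | h
    · exact absurd h' (hT.asymm _ _ h.2)
    · exact h.1
  have hpos : ∀ x, x ≠ z → 0 < α x := fun x hx =>
    lt_of_le_of_ne (hnn x) fun h => hx (hinj _ _ (by rw [hz0, ← h]))
  by_cases hdz : d = z
  · subst hdz
    exact hz e fun h => by rw [h] at hde; exact lt_irrefl _ hde
  have hd0 := hpos d hdz
  have hez : e ≠ z := by rintro rfl; linarith
  have hx0 := hpos x (hT.ne hzx).symm
  have hy0 := hpos y (hT.ne hyz)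
  have hxπ : α x < Real.pi := by have := hTgt z x (by linarith) hzx; linarith
  have hyπ : Real.pi < α y := by have := hTgt' z y (by linarith) hyz; linarith
  have hxy' := hTgt x y (by linarith) hxy
  have zd := hz d hdz
  have ze := hz e hez
  have zx := hz x (hT.ne hzx).symm
  have zy := hz y (hT.ne hyz)
  -- As `z` is the least index, the cyclic order of a cyclic triangle through `z` becomes a linear
  -- order.
  have pin : ∀ u w, T z u → T u w → T w z → u < w := by
    intro u w h1 h2 h3
    have := hT.cyc3 z u w h1 h2 h3
    have := hz u (hT.ne h1).symm
    have := hz w (hT.ne h3)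
    unfold Cyc3 at *
    grind
  have hxylt := pin x y hzx hxy hyz
  have low : ∀ d e, d ≠ z → α d < α e → α e < Real.pi → d < e := by
    intro d e hdz hde heπ
    have hd0 := hpos d hdz
    have zd := hz d hdz
    have hez : e ≠ z := by rintro rfl; linarith
    have ze := hz e hez
    have tzd : T z d := hTlt z d (by linarith) (by linarith)
    have tze : T z e := hTlt z e (by linarith) (by linarith)
    have tde : T d e := hTlt d e hde (by linarith)
    have hdy : d ≠ y := by rintro rfl; linarith
    have hey : e ≠ y := by rintro rfl; linarith
    -- If `e` turns to `y`, then `z e y` is cyclic with `d` between `z` and `e`. Otherwise `e`,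
    -- hence `d`, comes before `x` in angle, and the triangles `z x y` and `d x y` locate both.
    rcases htot e y hey with h | h
    · have := hT.cyc4_of_between tze h hyz tzd tde (htot _ _ hdy.symm)
      unfold Cyc4 at this
      grind
    · have h1 := hTgt' e y (by linarith) h
      have tex : T e x := hTlt e x (by linarith) (by linarith)
      have tdx : T d x := hTlt d x (by linarith) (by linarith)
      have tyd : T y d := (hα d y (by linarith)).elim (fun h => by linarith [h.1]) fun h => h.2
      have a1 := hT.cyc4_of_between hzx hxy hyz tzd tdx (htot _ _ hdy.symm)
      have a2 := hT.cyc4_of_between hzx hxy hyz tze tex (htot _ _ hey.symm)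
      have a3 := hT.cyc4_of_between tdx hxy tyd tde tex (htot _ _ hey.symm)
      unfold Cyc4 at a1 a2 a3
      grind
  -- Mirror image of `low`, with the roles of `x` and `y` exchanged.
  have high : ∀ d e, α d < α e → Real.pi < α d → d < e := by
    intro d e hde hdπ
    have hdz : d ≠ z := by rintro rfl; linarith
    have hez : e ≠ z := by rintro rfl; linarith
    have zd := hz d hdz
    have ze := hz e hez
    have he2 := hlt e
    have tdz : T d z := (hα z d (by linarith)).elim (fun h => by linarith [h.1]) fun h => h.2
    have tez : T e z := (hα z e (by linarith)).elim (fun h => by linarith [h.1]) fun h => h.2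
    have tde : T d e := hTlt d e hde (by linarith)
    have hdx : d ≠ x := by rintro rfl; linarith
    have hex : e ≠ x := by rintro rfl; linarith
    rcases htot x d hdx.symm with h | h
    · have := hT.cyc4_of_between tdz hzx h tde tez (htot _ _ hex.symm)
      unfold Cyc4 at this
      grind
    · have h1 := hTgt' x d (by linarith) h
      have tyd : T y d := hTlt y d (by linarith) (by linarith)
      have tye : T y e := hTlt y e (by linarith) (by linarith)
      have tex : T e x := (hα x e (by linarith)).elim (fun h => by linarith [h.1]) fun h => h.2
      have a1 := hT.cyc4_of_between hyz hzx hxy tyd tdz (htot _ _ hdx.symm)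
      have a2 := hT.cyc4_of_between hyz hzx hxy tye tez (htot _ _ hex.symm)
      have a3 := hT.cyc4_of_between tye tex hxy tyd tde (htot _ _ hdx.symm)
      unfold Cyc4 at a1 a2 a3
      grind
  have hdne : α d ≠ Real.pi := by
    intro h; rcases hα z d (by linarith) with h' | h' <;> linarith [h'.1]
  have hene : α e ≠ Real.pi := by
    intro h; rcases hα z e (by linarith) with h' | h' <;> linarith [h'.1]
  rcases lt_or_gt_of_ne hene with heπ | heπ
  · exact low d e hdz hde heπ
  rcases lt_or_gt_of_ne hdne with hdπ | hdπ
  swap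
  · exact high d e hde hdπ
  have tzd : T z d := hTlt z d (by linarith) (by linarith)
  have tez : T e z := (hα z e (by linarith)).elim (fun h => by linarith [h.1]) fun h => h.2
  rcases hα d e hde with ⟨-, h⟩ | ⟨h, -⟩
  · exact pin d e tzd h tez
  -- Here `d` and `e` lie on either side of `π` and more than `π` apart, so they are compared
  -- through `x` or `y`.
  rcases lt_trichotomy (α d) (α x) with hdx | hdx | hdx
  · have h1 := low d x hdz hdx hxπ
    rcases lt_or_ge (α e) (α y) with hey | hey
    · exact h1.trans (pin x e hzx (hTlt x e (by linarith) (by linarith)) tez)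
    · rcases hey.eq_or_lt with hey | hey
      · rw [← hinj _ _ hey]; exact h1.trans hxylt
      · exact h1.trans (hxylt.trans (high y e hey hyπ))
  · have := hinj _ _ hdx
    subst this
    exact hxylt.trans (high y e (by linarith) hyπ)
  · exact (pin d y tzd (hTlt d y (by linarith) (by linarith)) hyz).trans
      (high y e (by linarith) hyπ)

end CrossingTournament

theorem List.Pairwise.rel_of_mem_take {ι : Type*} {R : ι → ι → Prop} {l : List ι}
    (hl : l.Pairwise R) (hmem : ∀ x, x ∈ l) {k : ℕ} {x y : ι} (hx : x ∈ l.take k)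
    (hy : y ∉ l.take k) : R x y := by
  have h := hmem y
  rw [← List.take_append_drop k l] at hl h
  exact (List.pairwise_append.1 hl).2.2 x hx y ((List.mem_append.1 h).resolve_left hy)

theorem List.Pairwise.exists_append {ι : Type*} {R : ι → ι → Prop} {l : List ι}
    (hl : l.Pairwise R) {p : ι → Prop} (hp : ∀ a b, R a b → p b → p a) :
    ∃ l₁ l₂, l = l₁ ++ l₂ ∧ (∀ a ∈ l₁, p a) ∧ ∀ b ∈ l₂, ¬ p b := by
  induction l with
  | nil => exact ⟨[], [], rfl, by simp, by simp⟩
  | cons a l ih =>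
    rw [List.pairwise_cons] at hl
    by_cases ha : p a
    · obtain ⟨l₁, l₂, rfl, h1, h2⟩ := ih hl.2
      exact ⟨a :: l₁, l₂, rfl, by simpa [ha] using h1, h2⟩
    · refine ⟨[], a :: l, rfl, by simp, ?_⟩
      intro b hb hpb
      rcases List.mem_cons.1 hb with rfl | hb
      · exact ha hpb
      · exact ha (hp a b (hl.1 b hb) hpb)

/-- Along the list `l` the angles `θ` decrease within less than one full turn. -/
def ClockwiseAngles {ι : Type*} (θ : ι → ℝ) (l : List ι) : Prop :=
  l.Pairwise fun a b => θ b < θ a ∧ θ a < θ b + 2 * Real.pi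

theorem ClockwiseAngles.rotate {ι : Type*} {θ : ι → ℝ} {l₁ l₂ : List ι}
    (h : ClockwiseAngles θ (l₁ ++ l₂)) :
    ∃ θ' : ι → ℝ, ClockwiseAngles θ' (l₂ ++ l₁) ∧
      ∀ a b, Real.sin (θ' a - θ' b) = Real.sin (θ a - θ b) := by
  classical
  obtain ⟨h1, h2, h12⟩ := List.pairwise_append.1 h
  have hdisj : ∀ a ∈ l₂, a ∉ l₁ := fun a ha ha' => lt_irrefl _ (h12 a ha' a ha).1
  refine ⟨fun a => if a ∈ l₁ then θ a - 2 * Real.pi else θ a, ?_, ?_⟩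
  · refine List.pairwise_append.2 ⟨h2.imp_of_mem ?_, h1.imp_of_mem ?_, ?_⟩
    · intro a b ha hb hab
      simpa [hdisj a ha, hdisj b hb] using hab
    · intro a b ha hb hab
      simp only [ha, hb, if_true]
      constructor <;> linarith
    · intro a ha b hb
      have := h12 b hb a ha
      simp only [hdisj a ha, hb, if_true, if_false]
      constructor <;> linarith
  · intro a b
    dsimp only
    split_ifs
    · congr 1; ring
    · rw [← Real.sin_sub_two_pi (θ a - θ b)]; congr 1; ring
    · rw [← Real.sin_add_two_pi (θ a - θ b)]; congr 1; ring
    · rfl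

/-- Start the list at `z`. If `z` lies in a cyclic triangle, the list is increasing and its prefixes
are initial segments. If not, cutting it at angle `π` and exchanging the pieces makes it transitive
for `T`, so each prefix dominates its complement. -/
theorem CrossingTournament.exists_rotation {ι : Type*} [LinearOrder ι] {T : ι → ι → Prop}
    (hT : CrossingTournament T) {z : ι} (hz : ∀ x, x ≠ z → z < x) {θ : ι → ℝ} {l : List ι}
    (hl : ClockwiseAngles θ l) (hmem : ∀ x, x ∈ l)
    (hsin : ∀ a b, a ≠ b → Real.sin (θ a - θ b) ≠ 0)
    (hTsin : ∀ a b, a ≠ b → (T a b ↔ 0 < Real.sin (θ a - θ b))) :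
    ∃ l', l' ~r l ∧ ∀ k, NonAlternating fun x => x ∈ l'.take k := by
  obtain ⟨l₁, l₂, rfl⟩ := List.append_of_mem (hmem z)
  obtain ⟨θ', hl', hθ'⟩ := hl.rotate
  have hsin' : ∀ a b, a ≠ b → Real.sin (θ' a - θ' b) ≠ 0 := fun a b h => by
    rw [hθ']; exact hsin a b h
  have hTsin' : ∀ a b, a ≠ b → (T a b ↔ 0 < Real.sin (θ' a - θ' b)) := fun a b h => by
    rw [hθ']; exact hTsin a b h
  have hmem' : ∀ x, x ∈ z :: l₂ ++ l₁ := fun x => by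
    have := hmem x
    simp only [List.mem_append, List.mem_cons] at this ⊢
    tauto
  have hrot : (z :: l₂ ++ l₁) ~r (l₁ ++ z :: l₂) := List.isRotated_append
  have hπ := Real.pi_pos
  have hhead : ∀ x, x ≠ z → θ' x < θ' z ∧ θ' z < θ' x + 2 * Real.pi := by
    intro x hx
    have h := hl'
    rw [List.cons_append] at h
    refine (List.pairwise_cons.1 h).1 x ?_
    exact (List.mem_cons.1 (hmem' x)).resolve_left hx
  have hnn : ∀ x, 0 ≤ θ' z - θ' x := fun x => by
    by_cases hx : x = z
    · simp [hx]
    · linarith [hhead x hx]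
  have hlt : ∀ x, θ' z - θ' x < 2 * Real.pi := fun x => by
    by_cases hx : x = z
    · simp [hx, hπ]
    · linarith [hhead x hx]
  have hα : ∀ u w, θ' z - θ' u < θ' z - θ' w →
      (θ' z - θ' w) - (θ' z - θ' u) < Real.pi ∧ T u w ∨
      Real.pi < (θ' z - θ' w) - (θ' z - θ' u) ∧ T w u := by
    intro u w h
    have huw : u ≠ w := by rintro rfl; exact lt_irrefl _ h
    have h1 : (θ' z - θ' w) - (θ' z - θ' u) = θ' u - θ' w := by ring
    have h2 := hnn u
    have h3 := hlt w
    rw [h1]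
    rcases lt_trichotomy (θ' u - θ' w) Real.pi with h' | h' | h'
    · exact .inl ⟨h', (hTsin' u w huw).2 (Real.sin_pos_of_pos_of_lt_pi (by linarith) h')⟩
    · exact absurd (by rw [h', Real.sin_pi]) (hsin' u w huw)
    · refine .inr ⟨h', (hTsin' w u huw.symm).2 ?_⟩
      rw [← Real.sin_add_two_pi]
      exact Real.sin_pos_of_pos_of_lt_pi (by linarith) (by linarith)
  have hinj : ∀ u w, θ' z - θ' u = θ' z - θ' w → u = w := by
    intro u w h
    by_contra huw
    refine hsin' u w huw ?_
    rw [show θ' u - θ' w = 0 by linarith, Real.sin_zero]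
  by_cases hpin : ∃ x y, T z x ∧ T x y ∧ T y z
  · obtain ⟨x, y, hzx, hxy, hyz⟩ := hpin
    have hsorted : (z :: l₂ ++ l₁).Pairwise (· < ·) := hl'.imp fun {d e} h =>
      hT.lt_of_angle_lt (α := fun x => θ' z - θ' x) hz (by simp) hnn hlt hα hinj hzx hxy hyz
        (by simpa using h.1)
    refine ⟨_, hrot, fun k a b c d hab hbc hcd => ⟨?_, ?_⟩⟩
    · rintro ⟨-, hb, hc, -⟩
      exact hbc.asymm (hsorted.rel_of_mem_take hmem' hc hb)
    · rintro ⟨ha, hb, -, -⟩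
      exact hab.asymm (hsorted.rel_of_mem_take hmem' hb ha)
  · obtain ⟨m₁, m₂, hm, hm₁, hm₂⟩ := hl'.exists_append
      (p := fun x => θ' z - θ' x < Real.pi) fun a b h h' => by linarith [h.1]
    rw [hm] at hl' hmem' hrot
    obtain ⟨h1, h2, h12⟩ := List.pairwise_append.1 hl'
    have hsorted : (m₂ ++ m₁).Pairwise T := by
      refine List.pairwise_append.2 ⟨h2.imp_of_mem ?_, h1.imp_of_mem ?_, ?_⟩
      · intro a b ha hb hab
        rcases hα a b (by linarith [hab.1]) with h | h
        · exact h.2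
        · have := hm₂ a ha
          linarith [hlt b]
      · intro a b ha hb hab
        rcases hα a b (by linarith [hab.1]) with h | h
        · exact h.2
        · have := hm₁ b hb
          linarith [hnn a]
      · intro u hu w hw
        have hu' := not_lt.1 (hm₂ u hu)
        have hw' := hm₁ w hw
        have tuz : T u z := by
          rcases hα z u (by linarith) with h | h
          · linarith
          · exact h.2
        by_cases hwz : w = z
        · rwa [hwz]
        have tzw : T z w := by
          rcases hα z w (by linarith [hhead w hwz]) with h | h
          · exact h.2
          · linarith
        -- A turn from `w` to `u` would close the cyclic triangle `z w u`.
        rcases hα w u (by linarith) with h | h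
        · exact absurd ⟨w, u, tzw, h.2, tuz⟩ hpin
        · exact h.2
    have hmem'' : ∀ x, x ∈ m₂ ++ m₁ := fun x => by
      have := hmem' x
      simp only [List.mem_append] at this ⊢
      tauto
    exact ⟨_, List.isRotated_append.trans hrot, fun k => hT.nonAlternating_of_dominates
      fun a b ha hb => hsorted.rel_of_mem_take hmem'' ha hb⟩

/-! ### Alternating sums -/

theorem abs_sum_neg_one_pow_Ico_le (s e : ℕ) : |∑ i ∈ Finset.Ico s e, (-1 : ℤ) ^ i| ≤ 1 := by
  rcases le_total e s with h | h
  · simp [h]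
  · rw [Finset.sum_Ico_eq_sub _ h, neg_one_geom_sum, neg_one_geom_sum]
    split_ifs <;> simp

/-- Such a set is an interval: a gap, together with the index 0, the minimum and the maximum, would
alternate. -/
theorem NonAlternating.abs_sum_le_of_zero_notMem {m : ℕ} {A : Finset (Fin m)}
    (hA : NonAlternating (· ∈ A)) (h0 : ∀ i : Fin m, (i : ℕ) = 0 → i ∉ A) :
    |∑ i ∈ A, (-1 : ℤ) ^ (i : ℕ)| ≤ 1 := by
  rcases A.eq_empty_or_nonempty with rfl | hne
  · simp
  have key : ∀ i, i ∈ A ↔ A.min' hne ≤ i ∧ i ≤ A.max' hne := by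
    intro i
    refine ⟨fun h => ⟨A.min'_le i h, A.le_max' i h⟩, fun ⟨h1, h2⟩ => ?_⟩
    by_contra hi
    have hs := A.min'_mem hne
    have he := A.max'_mem hne
    have hzero : (⟨0, i.pos⟩ : Fin m) < A.min' hne := by
      rw [Fin.lt_def]
      exact Nat.pos_of_ne_zero fun h => h0 _ h hs
    exact (hA ⟨0, i.pos⟩ _ i _ hzero (lt_of_le_of_ne h1 fun h => hi (h ▸ hs))
      (lt_of_le_of_ne h2 fun h => hi (h ▸ he))).2 ⟨h0 _ rfl, hs, hi, he⟩
  have hsum : ∑ i ∈ A, (-1 : ℤ) ^ (i : ℕ) =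
      ∑ i ∈ Finset.Ico (A.min' hne : ℕ) (A.max' hne + 1), (-1 : ℤ) ^ i := by
    refine Finset.sum_bij (fun i _ => (i : ℕ)) ?_ ?_ ?_ ?_
    · intro i hi
      have := (key i).1 hi
      rw [Fin.le_def, Fin.le_def] at this
      rw [Finset.mem_Ico]
      omega
    · intro i _ j _ h; exact Fin.ext h
    · intro i hi
      rw [Finset.mem_Ico] at hi
      refine ⟨⟨i, by omega⟩, (key _).2 ?_, rfl⟩
      rw [Fin.le_def, Fin.le_def]
      simp only
      omega
    · intro i _; rfl
  rw [hsum]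
  exact abs_sum_neg_one_pow_Ico_le _ _

/-- For even `m` the signs sum to zero, so the set may be replaced by its complement when it
contains 0. -/
theorem NonAlternating.abs_sum_le {m : ℕ} (hm : Even m) {A : Finset (Fin m)}
    (hA : NonAlternating (· ∈ A)) : |∑ i ∈ A, (-1 : ℤ) ^ (i : ℕ)| ≤ 1 := by
  by_cases h : ∃ i : Fin m, (i : ℕ) = 0 ∧ i ∈ A
  · obtain ⟨j, hj, hjA⟩ := h
    have hc : NonAlternating (· ∈ Aᶜ) := by
      intro a b c d hab hbc hcd
      have := hA a b c d hab hbc hcd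
      simp only [Finset.mem_compl]
      tauto
    have h1 := hc.abs_sum_le_of_zero_notMem fun i hi => by
      rw [Finset.mem_compl, not_not]
      rwa [show i = j from Fin.ext (by omega)]
    have h2 := Finset.sum_add_sum_compl A fun i : Fin m => (-1 : ℤ) ^ (i : ℕ)
    rw [Fin.sum_univ_eq_sum_range (fun i => (-1 : ℤ) ^ i), neg_one_geom_sum, if_pos hm] at h2
    rw [eq_neg_of_add_eq_zero_left h2, abs_neg]
    exact h1
  · push Not at h
    exact hA.abs_sum_le_of_zero_notMem h

/-- A sum of `2 * k` signs is even, and here it has absolute value at most 1. -/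
theorem sum_take_eq_zero {n : ℕ} {l : List (Fin (2 * n))} (hl : l.Nodup)
    (hlen : l.length = 2 * n)
    (hA : ∀ k, NonAlternating fun x => x ∈ l.take k) {k : ℕ} (hk : k ≤ n) :
    ((l.take (2 * k)).map fun i : Fin (2 * n) => (-1 : ℤ) ^ (i : ℕ)).sum = 0 := by
  have hnd : (l.take (2 * k)).Nodup := hl.sublist (List.take_sublist _ _)
  have h1 := NonAlternating.abs_sum_le (even_two_mul n) (A := (l.take (2 * k)).toFinset)
    (by simpa using hA (2 * k))
  rw [List.sum_toFinset _ hnd] at h1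
  have h2 : ∀ l : List (Fin (2 * n)),
      ∃ m : ℤ, (l.map fun i : Fin (2 * n) => (-1 : ℤ) ^ (i : ℕ)).sum = l.length + 2 * m := by
    intro l
    induction l with
    | nil => exact ⟨0, by simp⟩
    | cons a l ih =>
      obtain ⟨m, hm⟩ := ih
      rcases neg_one_pow_eq_or ℤ (a : ℕ) with h | h
      · exact ⟨m, by simp [h, hm]; ring⟩
      · exact ⟨m - 1, by simp [h, hm]; ring⟩
  obtain ⟨m, hm⟩ := h2 (l.take (2 * k))
  rw [hm, List.length_take, hlen, min_eq_left (by omega)] at h1 ⊢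
  push_cast at h1 ⊢
  rw [abs_le] at h1
  omega

/-! ### Words made of two-coloured blocks. -/

/-- The words consisting of `n` blocks, each containing both colours. -/
def pairedWords : ℕ → Finset (List Color)
  | 0 => {[]}
  | n + 1 => (pairedWords n).image (fun w => Color.red :: Color.blue :: w) ∪
      (pairedWords n).image fun w => Color.blue :: Color.red :: w

theorem card_pairedWords_le (n : ℕ) : (pairedWords n).card ≤ 2 ^ n := by
  induction n with
  | zero => simp [pairedWords]
  | succ n ih =>
    rw [pairedWords, pow_succ]
    refine (Finset.card_union_le _ _).trans ?_
    have h1 := Finset.card_image_le (s := pairedWords n)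
      (f := fun w => Color.red :: Color.blue :: w)
    have h2 := Finset.card_image_le (s := pairedWords n)
      (f := fun w => Color.blue :: Color.red :: w)
    omega

/-- The sign of a colour. -/
def Color.sign : Color → ℤ
  | .red => 1
  | .blue => -1

theorem mem_pairedWords {n : ℕ} {w : List Color} (hw : w.length = 2 * n)
    (hsum : ∀ k ≤ n, ((w.take (2 * k)).map Color.sign).sum = 0) : w ∈ pairedWords n := by
  induction n generalizing w with
  | zero => simpa [pairedWords] using hw
  | succ n ih =>
    match w, hw with
    | a :: b :: w, hw =>
      have h1 := hsum 1 (by omega)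
      have h2 : w ∈ pairedWords n := by
        refine ih (by simp at hw; omega) fun k hk => ?_
        have := hsum (k + 1) (by omega)
        rw [show 2 * (k + 1) = 2 * k + 1 + 1 by ring] at this
        simp only [List.take_succ_cons, List.map_cons, List.sum_cons, List.map_nil, mul_one,
          List.take_zero, List.sum_nil, add_zero] at this h1
        linarith
      simp only [pairedWords, Finset.mem_union, Finset.mem_image]
      cases a <;> cases b <;> simp [Color.sign] at h1 <;> simp [h2]

/-! ### Crossing rays -/

/-- The cross product of two vectors of the plane. -/
def cross (z w : ℂ) : ℝ := z.re * w.im - z.im * w.re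

theorem cross_swap (z w : ℂ) : cross w z = -cross z w := by unfold cross; ring

theorem cross_circle (ρ θ φ : ℝ) :
    cross ((ρ : ℂ) * Complex.exp ((θ : ℂ) * Complex.I))
      ((ρ : ℂ) * Complex.exp ((φ : ℂ) * Complex.I)) = ρ ^ 2 * Real.sin (φ - θ) := by
  rw [Complex.exp_mul_I, Complex.exp_mul_I, ← Complex.ofReal_cos, ← Complex.ofReal_sin,
    ← Complex.ofReal_cos, ← Complex.ofReal_sin, Real.sin_sub]
  simp [cross, -Complex.ofReal_cos, -Complex.ofReal_sin]
  ring

/-- Far away, the turn from one ray to another has the sign of the cross product of their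
directions. -/
theorem eventually_sin_pos {p v q w : ℂ} (h : 0 < cross v w) :
    ∀ᶠ ρ : ℝ in atTop, ∀ θ φ : ℝ,
      (ρ : ℂ) * Complex.exp ((θ : ℂ) * Complex.I) ∈ ray p v →
      (ρ : ℂ) * Complex.exp ((φ : ℂ) * Complex.I) ∈ ray q w → 0 < Real.sin (φ - θ) := by
  -- Once both ray parameters are at least `M`, the term `t * s * cross v w` outweighs the other
  -- three, whose coefficients sum to `K` in absolute value.
  set K := |cross p q| + |cross p w| + |cross v q| with hK
  set M := max 1 ((K + 1) / cross v w) with hM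
  have hM1 : 1 ≤ M := le_max_left _ _
  have hMK : K + 1 ≤ M * cross v w := by
    rw [← div_le_iff₀ h]; exact le_max_right _ _
  filter_upwards [eventually_gt_atTop 0, eventually_gt_atTop (‖p‖ + M * ‖v‖),
    eventually_gt_atTop (‖q‖ + M * ‖w‖)] with ρ hρ hρp hρq θ φ hθ hφ
  have hnorm : ∀ ψ : ℝ, ‖(ρ : ℂ) * Complex.exp ((ψ : ℂ) * Complex.I)‖ = ρ := by
    intro ψ
    rw [norm_mul, Complex.norm_exp_ofReal_mul_I, mul_one, Complex.norm_real, Real.norm_of_nonneg hρ.le]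
  have hlarge : ∀ (x u : ℂ) (t ψ : ℝ), 0 ≤ t → ‖x‖ + M * ‖u‖ < ρ →
      (ρ : ℂ) * Complex.exp ((ψ : ℂ) * Complex.I) = x + t * u → M ≤ t := by
    intro x u t ψ ht hx he
    by_contra hlt
    have h1 := hnorm ψ
    rw [he] at h1
    have h2 := norm_add_le x (t * u)
    rw [norm_mul, Complex.norm_real, Real.norm_of_nonneg ht] at h2
    have h3 : t * ‖u‖ ≤ M * ‖u‖ := by gcongr; linarith
    linarith
  obtain ⟨t, ht, hzt⟩ := hθ
  obtain ⟨s, hs, hzs⟩ := hφ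
  have htM := hlarge p v t θ ht hρp hzt
  have hsM := hlarge q w s φ hs hρq hzs
  have hc := cross_circle ρ θ φ
  rw [hzt, hzs] at hc
  have he : cross (p + t * v) (q + s * w) =
      cross p q + s * cross p w + t * cross v q + t * s * cross v w := by
    simp [cross]; ring
  have hpos : 0 < cross (p + t * v) (q + s * w) := by
    rw [he]
    have a1 := neg_abs_le (cross p q)
    have a2 : s * -|cross p w| ≤ s * cross p w := by gcongr; exact neg_abs_le _
    have a3 : t * -|cross v q| ≤ t * cross v q := by gcongr; exact neg_abs_le _
    have b1 := abs_nonneg (cross p q)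
    have b2 := abs_nonneg (cross p w)
    have b3 := abs_nonneg (cross v q)
    have hs1 : 1 ≤ s := hM1.trans hsM
    have ht1 : 1 ≤ t := hM1.trans htM
    rcases le_total s t with hst | hst
    · have c1 : t * (K + 1) ≤ t * (s * cross v w) := by
        gcongr; exact hMK.trans (by gcongr)
      have c2 : s * |cross p w| ≤ t * |cross p w| := by gcongr
      have c3 : 1 * |cross p q| ≤ t * |cross p q| := by gcongr
      rw [hK] at c1
      linarith
    · have c1 : s * (K + 1) ≤ s * (t * cross v w) := by
        gcongr; exact hMK.trans (by gcongr)
      have c2 : t * |cross v q| ≤ s * |cross v q| := by gcongr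
      have c3 : 1 * |cross p q| ≤ s * |cross p q| := by gcongr
      rw [hK] at c1
      linarith
  rw [hc] at hpos
  exact pos_of_mul_pos_right hpos (by positivity)

/-- Parallel rays meeting away from their apices would share a segment, not a single point. -/
theorem RaysCross.exists_eq {p v q w : ℂ} (h : RaysCross p v q w) :
    cross v w ≠ 0 ∧ ∃ s t : ℝ, 0 < s ∧ 0 < t ∧ q - p = s * v - t * w := by
  obtain ⟨z, hz, hzp, hzq⟩ := h
  have hmem : z ∈ ray p v ∩ ray q w := by rw [hz]; rfl
  have huniq : ∀ y, y ∈ ray p v → y ∈ ray q w → y = z := fun y h1 h2 => by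
    have : y ∈ ray p v ∩ ray q w := ⟨h1, h2⟩
    rwa [hz] at this
  obtain ⟨⟨s, hs, hzs⟩, ⟨t, ht, hzt⟩⟩ := hmem
  have hs' : 0 < s := lt_of_le_of_ne hs fun h => hzp (by rw [hzs, ← h]; simp)
  have ht' : 0 < t := lt_of_le_of_ne ht fun h => hzq (by rw [hzt, ← h]; simp)
  refine ⟨fun hc => ?_, s, t, hs', ht', ?_⟩
  · have hv : v ≠ 0 := by rintro rfl; exact hzp (by rw [hzs]; simp)
    have hw : w ≠ 0 := by rintro rfl; exact hzq (by rw [hzt]; simp)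
    set d := v.re * w.re + v.im * w.im with hd
    have hpar : ((d : ℝ) : ℂ) * v = ((Complex.normSq v : ℝ) : ℂ) * w := by
      unfold cross at hc
      rw [Complex.normSq_apply, hd]
      apply Complex.ext <;> simp
      · linear_combination v.im * hc
      · linear_combination -v.re * hc
    have hN : 0 < Complex.normSq v := Complex.normSq_pos.2 hv
    have hmove : ∀ k : ℝ, 0 ≤ k → 0 ≤ s + k * d → z + ((k * Complex.normSq v : ℝ) : ℂ) * w = z := by
      intro k hk hsk
      refine huniq _ ⟨s + k * d, hsk, ?_⟩ ⟨t + k * Complex.normSq v, by positivity, ?_⟩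
      · rw [hzs]; push_cast; linear_combination -(k : ℂ) * hpar
      · rw [hzt]; push_cast; ring
    have hne : ∀ k : ℝ, 0 < k → 0 ≤ s + k * d → False := by
      intro k hk hsk
      have := hmove k hk.le hsk
      rw [add_eq_left, mul_eq_zero, Complex.ofReal_eq_zero] at this
      exact this.elim (by positivity) hw
    -- Equally directed rays also share points further on. Opposite ones share the way back to `p`,
    -- which `k = s / -d` reaches.
    rcases le_or_gt 0 d with hd0 | hd0
    · exact hne 1 one_pos (by positivity)
    · exact hne (s / -d) (div_pos hs' (by linarith)) (by
        rw [div_neg, neg_mul, div_mul_cancel₀ _ hd0.ne]; simp)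
  · have : p + s * v = q + t * w := by rw [← hzs, ← hzt]
    linear_combination -this

theorem cross_neg_of_semicircle {z : ℂ} {r : ℝ} {a b c : ℂ}
    (ha : ‖a - z‖ = r) (hb : ‖b - z‖ = r) (hc : ‖c - z‖ = r) (hb' : z.im ≤ b.im)
    (hab : a.re < b.re) (hbc : b.re < c.re) :
    cross (b - a) (c - a) < 0 := by
  have hsq : ∀ x : ℂ, ‖x - z‖ = r → (x.re - z.re) ^ 2 + (x.im - z.im) ^ 2 = r ^ 2 := by
    intro x hx
    rw [← hx, ← Complex.normSq_eq_norm_sq, Complex.normSq_apply, Complex.sub_re, Complex.sub_im]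
    ring
  have h1 := hsq a ha
  have h2 := hsq b hb
  have h3 := hsq c hc
  by_contra hneg
  rw [not_lt, cross, Complex.sub_re, Complex.sub_im, Complex.sub_re, Complex.sub_im] at hneg
  obtain ⟨x₁, hx₁⟩ : ∃ x₁, x₁ = a.re - z.re := ⟨_, rfl⟩
  obtain ⟨x₂, hx₂⟩ : ∃ x₂, x₂ = b.re - z.re := ⟨_, rfl⟩
  obtain ⟨x₃, hx₃⟩ : ∃ x₃, x₃ = c.re - z.re := ⟨_, rfl⟩
  obtain ⟨y₁, hy₁⟩ : ∃ y₁, y₁ = a.im - z.im := ⟨_, rfl⟩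
  obtain ⟨y₂, hy₂⟩ : ∃ y₂, y₂ = b.im - z.im := ⟨_, rfl⟩
  obtain ⟨y₃, hy₃⟩ : ∃ y₃, y₃ = c.im - z.im := ⟨_, rfl⟩
  rw [← hx₁, ← hy₁] at h1
  rw [← hx₂, ← hy₂] at h2
  rw [← hx₃, ← hy₃] at h3
  have hl : 0 < x₃ - x₂ := by linarith
  have hm : 0 < x₂ - x₁ := by linarith
  have hle : (x₃ - x₁) * y₂ ≤ (x₃ - x₂) * y₁ + (x₂ - x₁) * y₃ := by
    rw [show b.re - a.re = x₂ - x₁ by linarith, show c.im - a.im = y₃ - y₁ by linarith,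
      show b.im - a.im = y₂ - y₁ by linarith, show c.re - a.re = x₃ - x₁ by linarith] at hneg
    linarith
  have hy : 0 ≤ y₂ := by linarith
  have hle2 : ((x₃ - x₁) * y₂) ^ 2 ≤ ((x₃ - x₂) * y₁ + (x₂ - x₁) * y₃) ^ 2 :=
    pow_le_pow_left₀ (mul_nonneg (by linarith) hy) hle 2
  have hpos : 0 < (x₃ - x₂) * (x₂ - x₁) * ((x₁ - x₃) ^ 2 + (y₁ - y₃) ^ 2) := by
    have : 0 < (x₁ - x₃) ^ 2 := sq_pos_of_neg (by linarith)
    positivity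
  -- Up to the factor `(x₃ - x₁) ^ 2`, this says that the point of the chord at abscissa `x₂` is
  -- strictly inside the circle, hence closer to the horizontal diameter than the middle point.
  have hid : ((x₃ - x₂) * y₁ + (x₂ - x₁) * y₃) ^ 2 - ((x₃ - x₁) * y₂) ^ 2 =
      -((x₃ - x₂) * (x₂ - x₁) * ((x₁ - x₃) ^ 2 + (y₁ - y₃) ^ 2)) := by
    linear_combination ((x₃ - x₂) ^ 2 + (x₃ - x₂) * (x₂ - x₁)) * h1
      + ((x₂ - x₁) ^ 2 + (x₃ - x₂) * (x₂ - x₁)) * h3 - (x₃ - x₁) ^ 2 * h2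
  linarith

/-- Pairwise crossing rays with apices in convex position. -/
theorem crossingTournament_of_raysCross {m : ℕ} {p u : Fin m → ℂ}
    (hor : ∀ i j k, i < j → j < k → cross (p j - p i) (p k - p i) < 0)
    (hcross : ∀ i j, i ≠ j → RaysCross (p i) (u i) (p j) (u j)) :
    CrossingTournament fun i j => cross (u i) (u j) < 0 := by
  have hor' : ∀ i j k, Cyc3 i j k → cross (p j - p i) (p k - p i) < 0 := by
    rintro i j k (h | h | h)
    · exact hor i j k h.1 h.2
    · have := hor j k i h.1 h.2
      simp only [cross, Complex.sub_re, Complex.sub_im] at this ⊢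
      linarith
    · have := hor k i j h.1 h.2
      simp only [cross, Complex.sub_re, Complex.sub_im] at this ⊢
      linarith
  have hself : ∀ i, cross (u i) (u i) = 0 := fun i => by unfold cross; ring
  -- To meet ray `i`, the ray from an apex on its left must head to the right, and conversely.
  have hside : ∀ i j, i ≠ j → (cross (u i) (p j - p i) < 0 ↔ cross (u j) (u i) < 0) ∧
      (0 < cross (u i) (p j - p i) ↔ cross (u i) (u j) < 0) := by
    intro i j hij
    obtain ⟨-, s, t, hs, ht, h⟩ := (hcross i j hij).exists_eq
    have h1 : cross (u i) (p j - p i) = t * cross (u j) (u i) := by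
      rw [h]; simp [cross]; ring
    have h2 : cross (u i) (p j - p i) = t * -cross (u i) (u j) := by rw [h1, cross_swap]
    constructor
    · rw [h1, mul_neg_iff]
      constructor
      · rintro (⟨-, h⟩ | ⟨h, -⟩)
        · exact h
        · linarith
      · exact fun h => .inl ⟨ht, h⟩
    · rw [h2, mul_pos_iff_of_pos_left ht, neg_pos]
  -- In a convex quadrilateral `a b c d`, the diagonal `d - b` is a positive combination of the
  -- sides `a - b` and `c - b`; so if `a` and `c` are on one side of the line of ray `b`, so is `d`.
  have hquad : ∀ (w a b c d : ℂ), cross (c - b) (d - b) * cross w (a - b) +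
      cross (b - a) (d - a) * cross w (c - b) = cross (b - a) (c - a) * cross w (d - b) := by
    intro w a b c d
    simp only [cross, Complex.sub_re, Complex.sub_im]
    ring
  have hcyc : ∀ a b c d : Fin m, Cyc4 a b c d → Cyc3 b c d ∧ Cyc3 a b d ∧ Cyc3 a b c ∧ b ≠ d := by
    intro a b c d h
    unfold Cyc4 at h
    unfold Cyc3
    simp only [Fin.lt_def, ne_eq, Fin.ext_iff] at h ⊢
    omega
  refine ⟨?_, ?_, ?_, ?_⟩
  · intro a b h h'
    rw [cross_swap] at h'
    linarith
  · intro a b c d hc hab hcb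
    obtain ⟨c1, c2, c3, hbd⟩ := hcyc a b c d hc
    have hba : b ≠ a := by rintro rfl; rw [hself] at hab; exact lt_irrefl _ hab
    have hbc : b ≠ c := by rintro rfl; rw [hself] at hcb; exact lt_irrefl _ hcb
    have f1 := (hside b a hba).1.2 hab
    have f2 := (hside b c hbc).1.2 hcb
    refine (hside b d hbd).1.1 ?_
    have h1 := mul_pos_of_neg_of_neg (hor' _ _ _ c1) f1
    have h2 := mul_pos_of_neg_of_neg (hor' _ _ _ c2) f2
    have h3 := hquad (u b) (p a) (p b) (p c) (p d)
    by_contra hcon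
    have := mul_nonpos_of_nonpos_of_nonneg (hor' _ _ _ c3).le (not_lt.1 hcon)
    linarith
  · intro a b c d hc hab hcb
    obtain ⟨c1, c2, c3, hbd⟩ := hcyc a b c d hc
    have hba : b ≠ a := by rintro rfl; rw [hself] at hab; exact lt_irrefl _ hab
    have hbc : b ≠ c := by rintro rfl; rw [hself] at hcb; exact lt_irrefl _ hcb
    have f1 := (hside b a hba).2.2 hab
    have f2 := (hside b c hbc).2.2 hcb
    refine (hside b d hbd).2.1 ?_
    have h1 := mul_neg_of_neg_of_pos (hor' _ _ _ c1) f1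
    have h2 := mul_neg_of_neg_of_pos (hor' _ _ _ c2) f2
    have h3 := hquad (u b) (p a) (p b) (p c) (p d)
    by_contra hcon
    have := mul_nonneg_of_nonpos_of_nonpos (hor' _ _ _ c3).le (not_lt.1 hcon)
    linarith
  · intro a b c hab hbc hca
    have nab : a ≠ b := by rintro rfl; rw [hself] at hab; exact lt_irrefl _ hab
    have nbc : b ≠ c := by rintro rfl; rw [hself] at hbc; exact lt_irrefl _ hbc
    have nca : c ≠ a := by rintro rfl; rw [hself] at hca; exact lt_irrefl _ hca
    have hcases : Cyc3 a b c ∨ Cyc3 a c b := by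
      unfold Cyc3
      simp only [Fin.lt_def, ne_eq, Fin.ext_iff] at *
      omega
    refine hcases.resolve_right fun h => ?_
    have hneg := hor' a c b h
    obtain ⟨-, s₁, t₁, hs₁, ht₁, h₁⟩ := (hcross a b nab).exists_eq
    obtain ⟨-, s₂, t₂, hs₂, ht₂, h₂⟩ := (hcross a c nca.symm).exists_eq
    rw [h₁, h₂] at hneg
    have he : cross (s₂ * u a - t₂ * u c) (s₁ * u a - t₁ * u b) =
        -(s₁ * t₂ * cross (u c) (u a) + t₁ * s₂ * cross (u a) (u b)
          + t₁ * t₂ * cross (u b) (u c)) := by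
      simp [cross]; ring
    have h1 := mul_neg_of_pos_of_neg (mul_pos hs₁ ht₂) hca
    have h2 := mul_neg_of_pos_of_neg (mul_pos ht₁ hs₂) hab
    have h3 := mul_neg_of_pos_of_neg (mul_pos ht₁ ht₂) hbc
    linarith

/-! ### Upper bound for full-crossing rays. -/

namespace BichromaticSet

variable {n : ℕ}

theorem AlternatesOnSemicircle.mem_pairedWords_of_chiFeasible {S : BichromaticSet n}
    (hS : S.AlternatesOnSemicircle) {c : Configuration n} (hc : S.ChiFeasible c) :
    ∃ w ∈ pairedWords n, Cycle.ofList w = c.cycle := by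
  obtain ⟨z, r, p, -, hcirc, hmono, hmem, halt⟩ := hS
  obtain ⟨v, ⟨-, hcr⟩, hreal⟩ := hc
  have hpinj : Function.Injective p := fun i j h => hmono.injective (congrArg Complex.re h)
  have hpS : ∀ i, p i ∈ S.points := fun i => (hmem _).2 ⟨i, rfl⟩
  have hcross : ∀ i j, i ≠ j → RaysCross (p i) (v (p i)) (p j) (v (p j)) := fun i j hij =>
    hcr _ (hpS i) _ (hpS j) fun h => hij (hpinj h)
  have hT : CrossingTournament fun i j => cross (v (p i)) (v (p j)) < 0 :=
    crossingTournament_of_raysCross (u := fun i => v (p i)) (fun i j k hij hjk =>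
      cross_neg_of_semicircle (hcirc i).1 (hcirc j).1 (hcirc k).1 (hcirc j).2
        (hmono hij) (hmono hjk)) hcross
  have hsin : ∀ᶠ ρ : ℝ in atTop, ∀ i j : Fin (2 * n), 0 < cross (v (p i)) (v (p j)) →
      ∀ θ φ : ℝ, (ρ : ℂ) * Complex.exp ((θ : ℂ) * Complex.I) ∈ ray (p i) (v (p i)) →
      (ρ : ℂ) * Complex.exp ((φ : ℂ) * Complex.I) ∈ ray (p j) (v (p j)) →
        0 < Real.sin (φ - θ) := by
    rw [eventually_all]
    intro i
    rw [eventually_all]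
    intro j
    by_cases h : 0 < cross (v (p i)) (v (p j))
    · filter_upwards [eventually_sin_pos (p := p i) (q := p j) h] with ρ hρ _
      exact hρ
    · exact Eventually.of_forall fun ρ h' => absurd h' h
  -- A single circle, large enough for all pairs of rays at once, suffices.
  obtain ⟨ρ, ⟨l, ⟨hnd, hl, θ, hθ, hpair⟩, hlc⟩, hsin⟩ := (hreal.and hsin).exists
  obtain ⟨L, rfl⟩ : ∃ L : List (Fin (2 * n)), L.map p = l := by
    have : l ∈ Set.range (List.map p) := by
      rw [Set.range_list_map]
      intro x hx
      exact (hmem x).1 ((hl x).1 hx)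
    exact this
  have hLnd : L.Nodup := hnd.of_map p
  have hLmem : ∀ i, i ∈ L := fun i => (List.mem_map_of_injective hpinj).1 ((hl _).2 (hpS i))
  have hpos : ∀ i j, 0 < cross (v (p i)) (v (p j)) → 0 < Real.sin (θ (p j) - θ (p i)) :=
    fun i j h => hsin i j h _ _ (hθ _ (hpS i)) (hθ _ (hpS j))
  have hdich : ∀ i j, i ≠ j →
      cross (v (p i)) (v (p j)) < 0 ∧ 0 < Real.sin (θ (p i) - θ (p j)) ∨
      0 < cross (v (p i)) (v (p j)) ∧ Real.sin (θ (p i) - θ (p j)) < 0 := by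
    intro i j hij
    rcases lt_or_gt_of_ne (hcross i j hij).exists_eq.1 with h | h
    · exact .inl ⟨h, hpos j i (by rw [cross_swap]; linarith)⟩
    · refine .inr ⟨h, ?_⟩
      have := hpos i j h
      rw [← neg_sub, Real.sin_neg]
      linarith
  obtain ⟨L', hrot, hL'⟩ : ∃ L', L' ~r L ∧ ∀ k, NonAlternating fun x => x ∈ L'.take k := by
    rcases Nat.eq_zero_or_pos n with rfl | hn
    · exact ⟨L, .refl L, fun k a => a.elim0⟩
    · refine hT.exists_rotation (z := ⟨0, by omega⟩) (θ := fun i => θ (p i)) ?_ ?_ hLmem ?_ ?_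
      · intro x hx
        rw [Fin.lt_def]
        exact Nat.pos_of_ne_zero fun h => hx (Fin.ext h)
      · exact List.pairwise_map.1 hpair
      · intro i j hij
        rcases hdich i j hij with h | h
        · exact h.2.ne'
        · exact h.2.ne
      · intro i j hij
        rcases hdich i j hij with h | h
        · exact iff_of_true h.1 h.2
        · exact iff_of_false h.1.not_gt h.2.not_gt
  have hlen : L'.length = 2 * n := by
    rw [hrot.perm.length_eq, ← List.toFinset_card_of_nodup hLnd,
      show L.toFinset = Finset.univ by ext i; simp [hLmem i]]
    simp
  refine ⟨L'.map fun i => S.color (p i), mem_pairedWords (by simpa using hlen) ?_, ?_⟩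
  · intro k hk
    obtain ⟨h, hinj, hcol⟩ := S.exists_color_eq halt
    have hneg : (h true).sign = -(h false).sign := by
      have : h true ≠ h false := fun e => by simpa using hinj e
      revert this
      cases h true <;> cases h false <;> simp [Color.sign]
    have hsign : ∀ i : Fin (2 * n),
        (S.color (p i)).sign = (h false).sign * (-1 : ℤ) ^ (i : ℕ) := by
      intro i
      rw [hcol]
      rcases Nat.mod_two_eq_zero_or_one i with hi | hi
      · rw [(Nat.even_iff.2 hi).neg_one_pow]; simp [hi]
      · rw [(Nat.odd_iff.2 hi).neg_one_pow]; simp [hi, hneg]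
    have h0 := sum_take_eq_zero ((hrot.perm.nodup_iff).2 hLnd) hlen hL' hk
    rw [← List.map_take, List.map_map]
    have : (Color.sign ∘ fun i => S.color (p i)) =
        fun i : Fin (2 * n) => (h false).sign * (-1 : ℤ) ^ (i : ℕ) := funext hsign
    rw [this, List.sum_map_mul_left, h0, mul_zero]
  · rw [Configuration.cycle, ← hlc, Cycle.coe_eq_coe, List.map_map]
    exact hrot.map _

theorem AlternatesOnSemicircle.numChiFeasible_le {S : BichromaticSet n}
    (hS : S.AlternatesOnSemicircle) : S.numChiFeasible ≤ 2 ^ n := by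
  classical
  rw [numChiFeasible, ← Set.ncard_image_of_injective _ Configuration.cycle_injective]
  have hsub : Configuration.cycle '' {c : Configuration n | S.ChiFeasible c} ⊆
      ((pairedWords n).image (fun w : List Color => Cycle.ofList w) : Set (Cycle Color)) := by
    rintro _ ⟨c, hc, rfl⟩
    obtain ⟨w, hw, hwc⟩ := hS.mem_pairedWords_of_chiFeasible hc
    exact Finset.mem_coe.2 (Finset.mem_image.2 ⟨w, hw, hwc⟩)
  refine (Set.ncard_le_ncard hsub (Finset.finite_toSet _)).trans ?_
  rw [Set.ncard_coe_finset]
  exact Finset.card_image_le.trans (card_pairedWords_le n)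

/-! ### Existence of alternating sets. -/

/-- Points on the upper half of the unit circle. -/
noncomputable def semicirclePoint (n : ℕ) (k : ℕ) : ℂ :=
  -- For `k < 2 * n` the abscissae lie in `[0, 1)`; the right quarter circle is enough.
  ⟨k / (2 * n), √(1 - (k / (2 * n) : ℝ) ^ 2)⟩

theorem semicirclePoint_injective {n : ℕ} (hn : 0 < n) :
    Function.Injective (semicirclePoint n) := by
  intro i j h
  have := congrArg Complex.re h
  simp only [semicirclePoint] at this
  field_simp at this
  exact_mod_cast this

theorem exists_alternatesOnSemicircle (n : ℕ) :
    ∃ S : BichromaticSet n, S.AlternatesOnSemicircle := by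
  classical
  have hn : ∀ i, i < n → 0 < n := fun i hi => by omega
  have hinj : ∀ {n : ℕ}, 0 < n → ∀ i j, semicirclePoint n i = semicirclePoint n j → i = j :=
    fun hn i j h => semicirclePoint_injective hn h
  let S : BichromaticSet n :=
    { red := (Finset.range n).image fun k => semicirclePoint n (2 * k)
      blue := (Finset.range n).image fun k => semicirclePoint n (2 * k + 1)
      disjoint := by
        rw [Finset.disjoint_left]
        simp only [Finset.mem_image, Finset.mem_range]
        rintro _ ⟨i, hi, rfl⟩ ⟨j, -, h⟩
        have := hinj (hn i hi) _ _ h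
        omega
      card_red := by
        rw [Finset.card_image_of_injOn, Finset.card_range]
        intro i hi j _ h
        have := hinj (hn i (Finset.mem_range.1 hi)) _ _ h
        omega
      card_blue := by
        rw [Finset.card_image_of_injOn, Finset.card_range]
        intro i hi j _ h
        have := hinj (hn i (Finset.mem_range.1 hi)) _ _ h
        omega }
  have hcol : ∀ i, i < 2 * n → (S.color (semicirclePoint n i) = Color.red ↔ i % 2 = 0) := by
    intro i hi
    rw [color_eq_red_iff]
    simp only [S, Finset.mem_image, Finset.mem_range]
    constructor
    · rintro ⟨k, hk, h⟩
      have := hinj (hn k hk) _ _ h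
      omega
    · intro h
      exact ⟨i / 2, by omega, by congr 1; omega⟩
  refine ⟨S, 0, 1, fun i => semicirclePoint n i, one_pos, ?_, ?_, ?_, ?_⟩
  · intro i
    have hi : ((i : ℕ) : ℝ) / (2 * n) ≤ 1 := by
      apply div_le_one_of_le₀
      · exact_mod_cast i.2.le
      · positivity
    have h0 : (0 : ℝ) ≤ ((i : ℕ) : ℝ) / (2 * n) := by positivity
    have h1 : (((i : ℕ) : ℝ) / (2 * n)) ^ 2 ≤ 1 := pow_le_one₀ h0 hi
    refine ⟨?_, Real.sqrt_nonneg _⟩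
    rw [sub_zero, ← sq_eq_sq₀ (norm_nonneg _) zero_le_one, ← Complex.normSq_eq_norm_sq,
      Complex.normSq_apply]
    simp only [semicirclePoint]
    rw [Real.mul_self_sqrt (by linarith)]
    ring
  · intro i j hij
    have : 0 < n := by have := i.2; omega
    simp only [semicirclePoint]
    gcongr
    exact_mod_cast hij
  · intro x
    simp only [S, points, Finset.mem_union, Finset.mem_image, Finset.mem_range]
    constructor
    · rintro (⟨k, hk, rfl⟩ | ⟨k, hk, rfl⟩)
      · exact ⟨⟨2 * k, by omega⟩, rfl⟩
      · exact ⟨⟨2 * k + 1, by omega⟩, rfl⟩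
    · rintro ⟨i, rfl⟩
      have := i.2
      rcases Nat.mod_two_eq_zero_or_one i with h | h
      · exact .inl ⟨i / 2, by omega, by congr 1; omega⟩
      · exact .inr ⟨i / 2, by omega, by congr 1; omega⟩
  · intro i j hij h
    have h1 := hcol i i.2
    have h2 := hcol j j.2
    simp only at h
    rw [h, h2] at h1
    omega

end BichromaticSet

/-! ### Asymptotics. -/

theorem three_pow_div_sq_isBigO (S : (n : ℕ) → BichromaticSet n)
    (hS : ∀ n, (S n).AlternatesOnSemicircle) :
    (fun n : ℕ => (3 : ℝ) ^ n / (n : ℝ) ^ 2) =O[atTop] fun n : ℕ => ((S n).numFeasible : ℝ) := by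
  -- `9 = 3 ^ 2`, from `2 * n + 1 ≤ 3 * n` for `n ≥ 1`.
  refine IsBigO.of_bound 9 ?_
  filter_upwards [eventually_ge_atTop 1] with n hn
  have h : (3 : ℝ) ^ n ≤ (2 * n + 1) ^ 2 * ((S n).numFeasible : ℝ) := by
    exact_mod_cast (hS n).three_pow_le
  have hn' : (1 : ℝ) ≤ n := by exact_mod_cast hn
  rw [Real.norm_of_nonneg (by positivity), Real.norm_of_nonneg (by positivity),
    div_le_iff₀ (by positivity)]
  calc (3 : ℝ) ^ n ≤ (2 * n + 1) ^ 2 * ((S n).numFeasible : ℝ) := h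
    _ ≤ (3 * n) ^ 2 * ((S n).numFeasible : ℝ) := by gcongr; linarith
    _ = 9 * ((S n).numFeasible : ℝ) * (n : ℝ) ^ 2 := by ring

theorem numChiFeasible_isBigO (S : (n : ℕ) → BichromaticSet n)
    (hS : ∀ n, (S n).AlternatesOnSemicircle) :
    (fun n : ℕ => ((S n).numChiFeasible : ℝ)) =O[atTop] fun n : ℕ => (2 : ℝ) ^ n :=
  IsBigO.of_norm_le fun n => by
    rw [Real.norm_of_nonneg (by positivity)]
    exact_mod_cast (hS n).numChiFeasible_le

theorem two_pow_isLittleO_three_pow_div_sq :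
    (fun n : ℕ => (2 : ℝ) ^ n) =o[atTop] fun n : ℕ => (3 : ℝ) ^ n / (n : ℝ) ^ 2 := by
  have h := isLittleO_pow_const_mul_const_pow_const_pow_of_norm_lt (R := ℝ) 2
    (r₁ := 2) (r₂ := 3) (by norm_num)
  have h' := h.mul_isBigO (isBigO_refl (fun n : ℕ => ((n : ℝ) ^ 2)⁻¹) atTop)
  refine (h'.congr' ?_ ?_)
  · filter_upwards [eventually_ge_atTop 1] with n hn
    have : (n : ℝ) ≠ 0 := by positivity
    field_simp
  · exact Eventually.of_forall fun n => (div_eq_mul_inv _ _).symm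

theorem mainTheorem11 :
    (∃ S : (n : ℕ) → BichromaticSet n, ∀ n, (S n).AlternatesOnSemicircle) ∧
    ∀ S : (n : ℕ) → BichromaticSet n, (∀ n, (S n).AlternatesOnSemicircle) →
      ((fun n : ℕ => (3 : ℝ) ^ n / (n : ℝ) ^ 2) =O[atTop]
          fun n : ℕ => ((S n).numFeasible : ℝ)) ∧
      ((fun n : ℕ => ((S n).numChiFeasible : ℝ)) =O[atTop]
          fun n : ℕ => Real.goldenRatio ^ (2 * n)) ∧
      ((fun n : ℕ => ((S n).numChiFeasible : ℝ)) =o[atTop]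
          fun n : ℕ => ((S n).numFeasible : ℝ)) := by
  refine ⟨⟨fun n => (BichromaticSet.exists_alternatesOnSemicircle n).choose,
    fun n => (BichromaticSet.exists_alternatesOnSemicircle n).choose_spec⟩, fun S hS => ?_⟩
  have h1 := three_pow_div_sq_isBigO S hS
  have h2 := numChiFeasible_isBigO S hS
  refine ⟨h1, h2.trans (IsBigO.of_norm_le fun n => ?_),
    (h2.trans_isLittleO two_pow_isLittleO_three_pow_div_sq).trans_isBigO h1⟩
  -- `Φ ^ 2 = Φ + 1 > 2`, so the bound `2 ^ n` is stronger than the one claimed.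
  rw [Real.norm_of_nonneg (by positivity), pow_mul, Real.goldenRatio_sq]
  gcongr
  linarith [Real.one_lt_goldenRatio]
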